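/- Let $(V,Y,\mathbf 1,\omega)$ be a vertex operator algebra over $\mathbb C$ ($\mathbb Z$-graded by $L(0)$-eigenvalues, with finite-dimensional homogeneous subspaces $V_{(n)}$ that vanish for $n\ll 0$). Let $g_1,g_2$ be commuting automorphisms of $V$ of finite order and let $g_3=g_1g_2$; let $T_k$ be the order of $g_k$. For an automorphism $g$ of finite order $T$ put $V^{(g,r)}=\{v\in V: gv=e^{-2\pi i r/T}v\}$, $0\le r<T$. A weak $g$-twisted $V$-module is a vector space $W$ with a linear map $v\mapsto Y_W(v,x)=\sum_{n\in\frac1T\mathbb Z}v_nx^{-n-1}\in \operatorname{End}(W)[[x^{1/T},x^{-1/T}]]$ such that $Y_W(\mathbf 1,x)=\mathrm{id}_W$; $Y_W(v,x)w\in x^{r/T}W((x))$ for $v\in V^{(g,r)}$; and, for $v\in V^{(g,r)}$, $u\in V$, $$x_0^{-1}\delta\Big(\tfrac{x_1-x_2}{x_0}\Big)Y_W(v,x_1)Y_W(u,x_2)-x_0^{-1}\delta\Big(\tfrac{x_2-x_1}{-x_0}\Big)Y_W(u,x_2)Y_W(v,x_1)=x_1^{-1}\delta\Big(\tfrac{x_2+x_0}{x_1}\Big)\Big(\tfrac{x_2+x_0}{x_1}\Big)^{-r/T}Y_W(Y(v,x_0)u,x_2).$$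 It is called generalized if $W=\bigoplus_{\lambda\in\mathbb C}W_{(\lambda)}$, where $W_{(\lambda)}$ is the generalized $\lambda$-eigenspace of $L(0)=\omega_1$, and for every $\lambda$ one has $W_{(\lambda+n/T)}=0$ for all sufficiently negative integers $n$. Its restricted dual is $W'=\bigoplus_\lambda (W_{(\lambda)})^*$. Let $C_1(W)\subseteq W$ be the span of all $v_{-1}w$ with $v\in V^{(g,0)}$ homogeneous of weight $>0$, $w\in W$, and all $v_{-1-r/T}w$ with $1\le r\le T-1$, $v\in V^{(g,r)}$ homogeneous of weight $\ge 0$, $w\in W$. The module $W$ is $C_1$-cofinite if $\dim W/C_1(W)<\infty$. Let $W^k$ be a weak $g_k$-twisted $V$-module, $k=1,2,3$. A twisted logarithmic intertwining operator of type $\binom{W^3}{W^1\,W^2}$ is a linear map $$W^1\otimes W^2\to W^3[\log x]\{x\},\qquad w^1\otimes w^2\mapsto\mathcal Y(w^1,x)w^2=\sum_{n\in\mathbb C}\sum_{k\in\mathbb N}w^1_{n;k}w^2\,x^{-n-1}(\log x)^k$$ (for each $n$ only finitely many $k$ contribute) such that: (i) for all $w^1,w^2$ and $h\in\mathbb C$,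 $w^1_{h+n;k}w^2=0$ for all sufficiently large $n\in\mathbb N$, independently of $k$; (ii) for $0\le r_1<T_1$, $0\le r_2<T_2$ and $v\in V^{(g_1,r_1)}\cap V^{(g_2,r_2)}$, $$x_0^{-1}\delta\Big(\tfrac{x_1-x_2}{x_0}\Big)\Big(\tfrac{x_1-x_2}{x_0}\Big)^{-\frac{r_1}{T_1}}Y_{W^3}(v,x_1)\mathcal Y(w^1,x_2)w^2-x_0^{-1}\delta\Big(\tfrac{-x_2+x_1}{x_0}\Big)\Big(\tfrac{-x_2+x_1}{x_0}\Big)^{-\frac{r_1}{T_1}}\mathcal Y(w^1,x_2)Y_{W^2}(v,x_1)w^2$$ $$=x_1^{-1}\delta\Big(\tfrac{x_2+x_0}{x_1}\Big)\Big(\tfrac{x_2+x_0}{x_1}\Big)^{-\frac{r_2}{T_2}}\mathcal Y(Y_{W^1}(v,x_0)w^1,x_2)w^2,\qquad (-x)^\alpha:=e^{\pi i\alpha}x^\alpha;$$ (iii) $\mathcal Y(L(-1)w^1,x)=\frac{d}{dx}\mathcal Y(w^1,x)$, where $L(-1)=\omega_0$. It is surjective if its coefficients $w^1_{n;k}w^2$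 span $W^3$. A fusion product of generalized twisted modules $W^1,W^2$ is a generalized $g_3$-twisted module $W^1\boxtimes W^2$ with a twisted logarithmic intertwining operator $\mathcal Y^{\boxtimes}$ of type $\binom{W^1\boxtimes W^2}{W^1\,W^2}$ such that for every generalized $g_3$-twisted module $W$ and every twisted logarithmic intertwining operator $\mathcal Y$ of type $\binom{W}{W^1\,W^2}$ there is a unique module homomorphism $\phi:W^1\boxtimes W^2\to W$ with $\mathcal Y=\phi\circ\mathcal Y^{\boxtimes}$. **Theorem.** Let $W^1$ and $W^2$ be $C_1$-cofinite generalized $g_1$- and $g_2$-twisted $V$-modules. (a) Let $W^3$ be a generalized $g_3$-twisted $V$-module for which there is a surjective twisted logarithmic intertwining operator of type $\binom{W^3}{W^1\,W^2}$. Then the annihilator $\{f\in (W^3)' : f(C_1(W^3))=0\}$ has dimension at most $\dim(W^1/C_1(W^1))\cdot\dim(W^2/C_1(W^2))$, the module $W^3$ is $C_1$-cofinite, and $$\dim\big(W^3/C_1(W^3)\big)\le\dim\big(W^1/C_1(W^1)\big)\cdot\dim\big(W^2/C_1(W^2)\big).$$ (b) In particular, every fusion product $W^1\boxtimes W^2$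 of $W^1$ and $W^2$ is $C_1$-cofinite. -/

import Mathlib

open Complex

universe u v v₁ v₂ v₃

noncomputable section

/-! Formal series are recorded by their coefficients, and an identity of formal series is written as
the equality of all coefficients.  The sums `∑ᶠ i : ℕ` below come from binomial expansions; the lower
truncation conditions make each of them a finite sum. -/

/-- A vertex operator algebra `(V, Y, 𝟏, ω)` over `ℂ`, where `Y(a, x) b = ∑ₙ (mode n a b) x^{-n-1}`.
The homogeneous subspace `V_(n)` is the eigenspace of `L(0) = ω₁` for the eigenvalue `n`. -/
class VertexOperatorAlgebra (V : Type u) [AddCommGroup V] [Module ℂ V] where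
  /-- `mode n a b` is `aₙ b`. -/
  mode : ℤ → V →ₗ[ℂ] V →ₗ[ℂ] V
  /-- the vacuum vector `𝟏` -/
  vacuum : V
  /-- the conformal vector `ω` -/
  conformal : V
  /-- the central charge -/
  centralCharge : ℂ
  /-- lower truncation: `Y(a, x) b ∈ V((x))` -/
  truncation : ∀ a b : V, ∃ N : ℤ, ∀ n : ℤ, N ≤ n → mode n a b = 0
  /-- vacuum property: `Y(𝟏, x) = id` -/
  vacuum_mode : ∀ (n : ℤ) (b : V), mode n vacuum b = if n = -1 then b else 0
  /-- creation property: `Y(a, x) 𝟏 ∈ V[[x]]` has constant term `a` -/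
  creation_nonneg : ∀ (n : ℕ) (a : V), mode (n : ℤ) a vacuum = 0
  creation : ∀ a : V, mode (-1) a vacuum = a
  /-- Jacobi identity: coefficient of `x₀^{-n-1} x₁^{-m-1} x₂^{-h-1}` in
  `x₀⁻¹ δ((x₁-x₂)/x₀) Y(a,x₁) Y(b,x₂) c - x₀⁻¹ δ((x₂-x₁)/(-x₀)) Y(b,x₂) Y(a,x₁) c
    = x₁⁻¹ δ((x₂+x₀)/x₁) Y(Y(a,x₀)b, x₂) c`. -/
  jacobi : ∀ (a b c : V) (n m h : ℤ),
    (∑ᶠ i : ℕ, ((-1 : ℂ) ^ i * Ring.choose (n : ℂ) i) • mode (n + m - i) a (mode (h + i) b c))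
      - (∑ᶠ i : ℕ, (Ring.choose (n : ℂ) i * (-1 : ℂ) ^ (n - i)) •
          mode (h + n - i) b (mode (m + i) a c))
      = ∑ᶠ i : ℕ, Ring.choose (m : ℂ) i • mode (h + m - i) (mode (n + i) a b) c
  /-- Virasoro relations for `L(n) = ω_{n+1}` -/
  virasoro : ∀ (m n : ℤ) (b : V),
    mode (m + 1) conformal (mode (n + 1) conformal b)
        - mode (n + 1) conformal (mode (m + 1) conformal b)
      = ((m : ℂ) - n) • mode (m + n + 1) conformal b
        + (if m + n = 0 then ((m : ℂ) ^ 3 - m) / 12 * centralCharge else 0) • b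
  /-- `Y(L(-1) a, x) = d/dx Y(a, x)` -/
  derivative : ∀ (n : ℤ) (a b : V),
    mode n (mode 0 conformal a) b = (-(n : ℂ)) • mode (n - 1) a b
  /-- `V = ⨁_{n ∈ ℤ} V_(n)` -/
  grading : DirectSum.IsInternal
    fun n : ℤ => Module.End.eigenspace (mode 1 conformal) (n : ℂ)
  /-- `dim V_(n) < ∞` -/
  finite_weight : ∀ n : ℤ,
    FiniteDimensional ℂ (Module.End.eigenspace (mode 1 conformal) (n : ℂ))
  /-- `V_(n) = 0` for `n` sufficiently negative -/
  bounded_below : ∃ N : ℤ, ∀ n : ℤ, n < N →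
    Module.End.eigenspace (mode 1 conformal) (n : ℂ) = ⊥
  /-- `𝟏 ∈ V_(0)` -/
  vacuum_weight : vacuum ∈ Module.End.eigenspace (mode 1 conformal) (0 : ℂ)
  /-- `ω ∈ V_(2)` -/
  conformal_weight : conformal ∈ Module.End.eigenspace (mode 1 conformal) (2 : ℂ)

namespace VertexOperatorAlgebra

/-- The subspace `V_(n)` of vectors of weight `n`. -/
def weight (V : Type u) [AddCommGroup V] [Module ℂ V] [VertexOperatorAlgebra V] (n : ℤ) :
    Submodule ℂ V :=
  Module.End.eigenspace (mode (V := V) 1 conformal) (n : ℂ)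

/-- The group of automorphisms of the vertex operator algebra `V`. -/
def Aut (V : Type u) [AddCommGroup V] [Module ℂ V] [VertexOperatorAlgebra V] :
    Subgroup (V ≃ₗ[ℂ] V) where
  carrier := {g | (∀ (n : ℤ) (a b : V), g (mode n a b) = mode n (g a) (g b)) ∧
    g vacuum = vacuum ∧ g conformal = conformal}
  one_mem' := ⟨fun _ _ _ => rfl, rfl, rfl⟩
  mul_mem' := by
    rintro g h ⟨hg, hg1, hg2⟩ ⟨hh, hh1, hh2⟩
    refine ⟨fun n a b => ?_, ?_, ?_⟩
    · rw [LinearEquiv.mul_apply, hh, hg]; rfl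
    · rw [LinearEquiv.mul_apply, hh1, hg1]
    · rw [LinearEquiv.mul_apply, hh2, hg2]
  inv_mem' := by
    rintro g ⟨hg, hg1, hg2⟩
    refine ⟨fun n a b => ?_, ?_, ?_⟩
    · change g.symm _ = mode n (g.symm a) (g.symm b)
      rw [LinearEquiv.symm_apply_eq, hg, LinearEquiv.apply_symm_apply,
        LinearEquiv.apply_symm_apply]
    · change g.symm _ = _
      rw [LinearEquiv.symm_apply_eq, hg1]
    · change g.symm _ = _
      rw [LinearEquiv.symm_apply_eq, hg2]

/-- `V^{(g,r)} = {v | g v = e^{-2πi r/T} v}`, where `T` is the order of `g`. -/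
def eigen {V : Type u} [AddCommGroup V] [Module ℂ V] [VertexOperatorAlgebra V] (g : Aut V)
    (r : ℕ) : Submodule ℂ V :=
  Module.End.eigenspace (((g : V ≃ₗ[ℂ] V) : V →ₗ[ℂ] V))
    (exp (-(2 * Real.pi * I * (r / orderOf g : ℂ))))

end VertexOperatorAlgebra

open VertexOperatorAlgebra

/-- The fraction `r / T`, where `T` is the order of `g`. -/
def twist {V : Type u} [AddCommGroup V] [Module ℂ V] [VertexOperatorAlgebra V] (g : Aut V)
    (r : ℕ) : ℂ := (r : ℂ) / (orderOf g : ℂ)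

/-- A weak `g`-twisted `V`-module structure on `W`, for an automorphism `g` of finite order `T`;
here `Y_W(a, x) w = ∑ₙ (mode n a w) x^{-n-1}`, the sum being over `n ∈ (1/T)ℤ`. -/
structure WeakTwistedModule {V : Type u} [AddCommGroup V] [Module ℂ V] [VertexOperatorAlgebra V]
    (g : Aut V) (W : Type v) [AddCommGroup W] [Module ℂ W] where
  /-- `mode n a w` is `aₙ w`. -/
  mode : ℂ → V →ₗ[ℂ] W →ₗ[ℂ] W
  /-- only exponents in `(1/T)ℤ` occur -/
  mode_support : ∀ n : ℂ, (¬ ∃ k : ℤ, n = (k : ℂ) / (orderOf g : ℂ)) → mode n = 0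
  /-- `Y_W(𝟏, x) = id` -/
  vacuum_mode : ∀ (n : ℂ) (w : W), mode n vacuum w = if n = -1 then w else 0
  /-- `Y_W(a, x) w ∈ x^{r/T} W((x))` for `a ∈ V^{(g,r)}`: the exponents lie in `r/T + ℤ` ... -/
  twist_support : ∀ r : ℕ, r < orderOf g → ∀ a ∈ eigen g r, ∀ (w : W) (n : ℂ),
    (¬ ∃ k : ℤ, n = k - twist g r) → mode n a w = 0
  /-- ... and are bounded below -/
  truncation : ∀ r : ℕ, r < orderOf g → ∀ a ∈ eigen g r, ∀ w : W,
    ∃ N : ℤ, ∀ k : ℤ, N ≤ k → mode (k - twist g r) a w = 0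
  /-- Twisted Jacobi identity for `a ∈ V^{(g,r)}`: coefficient of
  `x₀^{-n-1} x₁^{-(m-r/T)-1} x₂^{-h-1}` in
  `x₀⁻¹ δ((x₁-x₂)/x₀) Y_W(a,x₁) Y_W(b,x₂) w - x₀⁻¹ δ((x₂-x₁)/(-x₀)) Y_W(b,x₂) Y_W(a,x₁) w
    = x₁⁻¹ δ((x₂+x₀)/x₁) ((x₂+x₀)/x₁)^{-r/T} Y_W(Y(a,x₀)b, x₂) w`
  (all other coefficients vanish by the support conditions). -/
  jacobi : ∀ r : ℕ, r < orderOf g → ∀ a ∈ eigen g r, ∀ (b : V) (w : W) (n m : ℤ) (h : ℂ),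
    (∑ᶠ i : ℕ, ((-1 : ℂ) ^ i * Ring.choose (n : ℂ) i) •
        mode (n + (m - twist g r) - i) a (mode (h + i) b w))
      - (∑ᶠ i : ℕ, (Ring.choose (n : ℂ) i * (-1 : ℂ) ^ (n - i)) •
          mode (h + n - i) b (mode (m - twist g r + i) a w))
      = ∑ᶠ i : ℕ, Ring.choose (m - twist g r) i •
          mode (h + (m - twist g r) - i) (VertexOperatorAlgebra.mode (n + i) a b) w

namespace WeakTwistedModule

section

variable {V : Type u} [AddCommGroup V] [Module ℂ V] [VertexOperatorAlgebra V] {g : Aut V}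
  {W : Type v} [AddCommGroup W] [Module ℂ W]

/-- `W_(c)`, the generalized eigenspace of `L(0) = ω₁` on `W` for the eigenvalue `c`. -/
def weightSpace (M : WeakTwistedModule g W) (c : ℂ) : Submodule ℂ W :=
  Module.End.maxGenEigenspace (M.mode 1 conformal) c

/-- `M` is a generalized `g`-twisted module: `W = ⨁_{c ∈ ℂ} W_(c)`, and for each `c` the space
`W_(c + n/T)` vanishes for all sufficiently negative integers `n`. -/
structure IsGeneralized (M : WeakTwistedModule g W) : Prop where
  decomposition : DirectSum.IsInternal M.weightSpace
  lower_truncated : ∀ c : ℂ, ∃ N : ℤ, ∀ n : ℤ, n < N →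
    M.weightSpace (c + (n : ℂ) / (orderOf g : ℂ)) = ⊥

/-- `C₁(W)`: the span of `a_{-1} w` for `a ∈ V^{(g,0)}` homogeneous of positive weight, and of
`a_{-1-r/T} w` for `a ∈ V^{(g,r)}` homogeneous of nonnegative weight, `1 ≤ r ≤ T - 1`. -/
def C1 (M : WeakTwistedModule g W) : Submodule ℂ W :=
  Submodule.span ℂ {x | ∃ n : ℤ, 0 < n ∧ ∃ a ∈ eigen g 0 ⊓ weight V n, ∃ w : W,
      x = M.mode (-1) a w} ⊔
  Submodule.span ℂ {x | ∃ r : ℕ, 1 ≤ r ∧ r < orderOf g ∧ ∃ n : ℤ, 0 ≤ n ∧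
      ∃ a ∈ eigen g r ⊓ weight V n, ∃ w : W, x = M.mode (-1 - twist g r) a w}

/-- `W` is `C₁`-cofinite. -/
def IsC1Cofinite (M : WeakTwistedModule g W) : Prop :=
  FiniteDimensional ℂ (W ⧸ M.C1)

/-- The restricted dual `W' = ⨁_c (W_(c))*`: the linear functionals on `W = ⨁_c W_(c)` that vanish
on all but finitely many of the weight spaces. -/
def restrictedDual (M : WeakTwistedModule g W) : Submodule ℂ (Module.Dual ℂ W) where
  carrier := {f | {c : ℂ | ∃ w ∈ M.weightSpace c, f w ≠ 0}.Finite}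
  zero_mem' := by simp
  add_mem' := by
    intro f f' hf hf'
    refine (hf.union hf').subset ?_
    rintro c ⟨w, hw, hne⟩
    by_cases h : f w = 0
    · right
      refine ⟨w, hw, fun h' => hne ?_⟩
      simp [h, h']
    · exact Or.inl ⟨w, hw, h⟩
  smul_mem' := by
    intro s f hf
    refine hf.subset ?_
    rintro c ⟨w, hw, hne⟩
    refine ⟨w, hw, fun h => hne ?_⟩
    simp [h]

/-- The annihilator of `C₁(W)` in the restricted dual `W'`. -/
def C1Annihilator (M : WeakTwistedModule g W) : Submodule ℂ (Module.Dual ℂ W) :=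
  M.restrictedDual ⊓ M.C1.dualAnnihilator

/-- Homomorphisms of twisted modules. -/
def IsHom {W' : Type v₁} [AddCommGroup W'] [Module ℂ W'] (M : WeakTwistedModule g W)
    (M' : WeakTwistedModule g W') (f : W →ₗ[ℂ] W') : Prop :=
  ∀ (n : ℂ) (a : V) (w : W), f (M.mode n a w) = M'.mode n a (f w)

end

end WeakTwistedModule

/-- A twisted logarithmic intertwining operator `𝒴` of type `(W³ over W¹ W²)`, where `Wᵏ` is
`gₖ`-twisted and `g₃ = g₁ g₂`; here
`𝒴(w₁, x) w₂ = ∑_{n ∈ ℂ} ∑_{k ∈ ℕ} (coeff n k w₁ w₂) x^{-n-1} (log x)^k`. -/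
structure TwistedIntertwiningOperator {V : Type u} [AddCommGroup V] [Module ℂ V]
    [VertexOperatorAlgebra V] {g₁ g₂ : Aut V}
    {W₁ : Type v₁} [AddCommGroup W₁] [Module ℂ W₁]
    {W₂ : Type v₂} [AddCommGroup W₂] [Module ℂ W₂]
    {W₃ : Type v₃} [AddCommGroup W₃] [Module ℂ W₃]
    (M₁ : WeakTwistedModule g₁ W₁) (M₂ : WeakTwistedModule g₂ W₂)
    (M₃ : WeakTwistedModule (g₁ * g₂) W₃) where
  /-- `coeff n k w₁ w₂` is the coefficient of `x^{-n-1} (log x)^k` in `𝒴(w₁, x) w₂`. -/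
  coeff : ℂ → ℕ → W₁ →ₗ[ℂ] W₂ →ₗ[ℂ] W₃
  /-- `𝒴(w₁, x) w₂ ∈ W₃[log x]{x}`: each power of `x` has a polynomial in `log x` as coefficient -/
  log_finite : ∀ (w₁ : W₁) (w₂ : W₂) (n : ℂ), {k : ℕ | coeff n k w₁ w₂ ≠ 0}.Finite
  /-- lower truncation, uniformly in the power of `log x` -/
  truncation : ∀ (w₁ : W₁) (w₂ : W₂) (h : ℂ), ∃ N : ℕ, ∀ n : ℕ, N ≤ n → ∀ k : ℕ,
    coeff (h + n) k w₁ w₂ = 0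
  /-- Twisted Jacobi identity for `a ∈ V^{(r₁,r₂)}`, with `α = r₁/T₁` and `β = r₂/T₂`:
  coefficient of `x₀^{-(n-α)-1} x₁^{-(m-β)-1} x₂^{-h-1} (log x₂)^k` in
  `x₀⁻¹ δ((x₁-x₂)/x₀) ((x₁-x₂)/x₀)^{-α} Y_{W₃}(a,x₁) 𝒴(w₁,x₂) w₂
    - x₀⁻¹ δ((-x₂+x₁)/x₀) ((-x₂+x₁)/x₀)^{-α} 𝒴(w₁,x₂) Y_{W₂}(a,x₁) w₂
    = x₁⁻¹ δ((x₂+x₀)/x₁) ((x₂+x₀)/x₁)^{-β} 𝒴(Y_{W₁}(a,x₀) w₁, x₂) w₂`,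
  where `(-x)^c = e^{πic} x^c` (all other coefficients vanish by the support conditions). -/
  jacobi : ∀ r₁ r₂ : ℕ, r₁ < orderOf g₁ → r₂ < orderOf g₂ →
    ∀ a ∈ eigen g₁ r₁ ⊓ eigen g₂ r₂, ∀ (w₁ : W₁) (w₂ : W₂) (n m : ℤ) (h : ℂ) (k : ℕ),
    (∑ᶠ i : ℕ, ((-1 : ℂ) ^ i * Ring.choose (n - twist g₁ r₁) i) •
        M₃.mode ((n - twist g₁ r₁) + (m - twist g₂ r₂) - i) a (coeff (h + i) k w₁ w₂))
      - (∑ᶠ i : ℕ, (Ring.choose (n - twist g₁ r₁) i *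
            exp (Real.pi * I * (n - twist g₁ r₁ - i))) •
          coeff (h + (n - twist g₁ r₁) - i) k w₁ (M₂.mode (m - twist g₂ r₂ + i) a w₂))
      = ∑ᶠ i : ℕ, Ring.choose (m - twist g₂ r₂) i •
          coeff (h + (m - twist g₂ r₂) - i) k (M₁.mode (n - twist g₁ r₁ + i) a w₁) w₂
  /-- `𝒴(L(-1) w₁, x) = d/dx 𝒴(w₁, x)`, with `L(-1) = ω₀`: coefficient of `x^{-n-1} (log x)^k` -/
  derivative : ∀ (w₁ : W₁) (w₂ : W₂) (n : ℂ) (k : ℕ),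
    coeff n k (M₁.mode 0 conformal w₁) w₂
      = (-n) • coeff (n - 1) k w₁ w₂ + ((k : ℂ) + 1) • coeff (n - 1) (k + 1) w₁ w₂

namespace TwistedIntertwiningOperator

section

variable {V : Type u} [AddCommGroup V] [Module ℂ V] [VertexOperatorAlgebra V] {g₁ g₂ : Aut V}
    {W₁ : Type v₁} [AddCommGroup W₁] [Module ℂ W₁]
    {W₂ : Type v₂} [AddCommGroup W₂] [Module ℂ W₂]
    {W₃ : Type v₃} [AddCommGroup W₃] [Module ℂ W₃]
    {M₁ : WeakTwistedModule g₁ W₁} {M₂ : WeakTwistedModule g₂ W₂}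
    {M₃ : WeakTwistedModule (g₁ * g₂) W₃}

/-- `Im 𝒴`, the span of all the coefficients of all the series `𝒴(w₁, x) w₂`. -/
def image (Y : TwistedIntertwiningOperator M₁ M₂ M₃) : Submodule ℂ W₃ :=
  Submodule.span ℂ {x | ∃ (n : ℂ) (k : ℕ) (w₁ : W₁) (w₂ : W₂), x = Y.coeff n k w₁ w₂}

/-- `𝒴` is surjective. -/
def IsSurjective (Y : TwistedIntertwiningOperator M₁ M₂ M₃) : Prop :=
  Y.image = ⊤

/-- `(W₃, 𝒴)` is a fusion product of `W₁` and `W₂`: `W₃` is a generalized `g₁g₂`-twisted module, and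
every twisted logarithmic intertwining operator from `W₁`, `W₂` to a generalized `g₁g₂`-twisted
module `U` is `φ ∘ 𝒴` for a unique homomorphism `φ : W₃ → U`. -/
def IsFusionProduct (Y : TwistedIntertwiningOperator M₁ M₂ M₃) : Prop :=
  M₃.IsGeneralized ∧
  ∀ (U : Type v₃) [AddCommGroup U] [Module ℂ U] (N : WeakTwistedModule (g₁ * g₂) U),
    N.IsGeneralized → ∀ Z : TwistedIntertwiningOperator M₁ M₂ N,
      ∃! φ : W₃ →ₗ[ℂ] U, M₃.IsHom N φ ∧
        ∀ (n : ℂ) (k : ℕ) (w₁ : W₁) (w₂ : W₂), Z.coeff n k w₁ w₂ = φ (Y.coeff n k w₁ w₂)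

end

end TwistedIntertwiningOperator

end

/-! The tool is specialization at `x = 1`. For `f` in the restricted dual of `W³`, put `B_f(w₁, w₂)
= ⟨f, 𝒴(w₁, 1) w₂⟩` with `log 1 = 0` (`evalOne`). The sum over powers of `x` is finite because
coefficients of homogeneous vectors are homogeneous and `f` sees only finitely many weights.

Let `f` kill `C₁(W³)`, and let `a` be a common eigenvector of `g₁`, `g₂` with fractions `α`, `β`. If
the exponents `n`, `m` in the Jacobi identity add up to `-1`, its first term contains only the modes
`a_{-1-α-β-i}`, which land in `C₁(W³)`. The other two terms therefore give a linear relation between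
values of `B_f`. Taking `(n, m) = (-1, 0)` expresses `B_f(a_{-1-α} w₁, w₂)` through values of
strictly smaller total weight, and `(0, -1)` does the same for `B_f(w₁, a_{-1-β} w₂)`. Weights are
bounded below on each coset, so induction on total weight (`evalOne_eq_zero`) shows that `B_f` is
determined by its values on representatives of `W¹/C₁(W¹)` and `W²/C₁(W²)`.

Next, `f ↦ B_f` is injective when `𝒴` is surjective. If `B_f = 0`, the commutator of `L(0)` with `𝒴`
gives `B_{f ∘ L(0)^j} = 0` for every `j`. Since different powers of `x` carry different weights,
this separates them, and the `L(-1)`-derivative property then reaches the powers of `log x`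
(`pairing_eq_zero_of_evalOne_eq_zero`). So `f` kills the image of `𝒴`, and the annihilator embeds in
a space of matrices of the required size.

Finally, `C₁(W³)` is graded, so its annihilator in the restricted dual separates the points of
`W³/C₁(W³)`, which bounds that quotient. For (b), the image of `𝒴` is a submodule, and the
uniqueness clause of the universal property, tested on the quotient by it, makes `𝒴` surjective. -/

noncomputable section

/-! ### Linear algebra of independent families and generalized eigenspaces. -/

section LinearAlgebra

/-- In an independent family, shrinking the members and adding all other members back does not
enlarge the intersection with a given member. -/
lemma iSupIndep.inf_sup_le {ι α : Type*} [CompleteLattice α] [IsModularLattice α] {G B : ι → α}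
    (hG : iSupIndep G) {i : ι} (hB : B i ≤ G i) :
    G i ⊓ (B i ⊔ ⨆ (j) (_ : j ≠ i), G j) ≤ B i := by
  rw [inf_comm, sup_inf_assoc_of_le _ hB, inf_comm, (hG i).eq_bot, sup_bot_eq]

lemma iSup_le_sup_iSup_ne {ι α : Type*} [CompleteLattice α] {G B : ι → α} (hB : ∀ j, B j ≤ G j)
    (i : ι) : ⨆ j, B j ≤ B i ⊔ ⨆ (j) (_ : j ≠ i), G j := by
  refine iSup_le fun j => ?_
  by_cases h : j = i
  · subst h; exact le_sup_left
  · exact le_sup_of_le_right (le_iSup₂_of_le j h (hB j))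

lemma iSupIndep.inf_iSup_le {ι α : Type*} [CompleteLattice α] [IsModularLattice α] {G B : ι → α}
    (hG : iSupIndep G) (hB : ∀ j, B j ≤ G j) (i : ι) : G i ⊓ ⨆ j, B j ≤ B i :=
  (inf_le_inf_left _ (iSup_le_sup_iSup_ne hB i)).trans (hG.inf_sup_le (hB i))

variable {E F : Type*} [AddCommGroup E] [Module ℂ E] [AddCommGroup F] [Module ℂ F]

lemma iSupIndep.eq_zero_of_sum_eq_zero {ι : Type*} {G : ι → Submodule ℂ E} (hG : iSupIndep G)
    (s : Finset ι) (x : ι → E) (hx : ∀ i ∈ s, x i ∈ G i) (h : ∑ i ∈ s, x i = 0) :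
    ∀ i ∈ s, x i = 0 := by
  classical
  intro i hi
  have h1 : x i = -∑ j ∈ s.erase i, x j := by
    rw [← Finset.add_sum_erase s x hi] at h
    exact eq_neg_of_add_eq_zero_left h
  refine (Submodule.disjoint_def.mp (hG i)) _ (hx i hi) ?_
  rw [h1]
  refine Submodule.neg_mem _ (Submodule.sum_mem _ fun j hj => ?_)
  rw [Finset.mem_erase] at hj
  exact Submodule.mem_iSup_of_mem j (Submodule.mem_iSup_of_mem hj.1 (hx j hj.2))

/-- A linear map that shifts the operators `L`, `L'` by `δ` shifts generalized eigenspaces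
by `δ`. -/
lemma map_mem_maxGenEigenspace_add (L : Module.End ℂ E) (L' : Module.End ℂ F) (A : E →ₗ[ℂ] F)
    (δ : ℂ) (hA : ∀ x, L' (A x) = A (L x) + δ • A x) (μ : ℂ) {x : E}
    (hx : x ∈ L.maxGenEigenspace μ) : A x ∈ L'.maxGenEigenspace (μ + δ) := by
  rw [Module.End.mem_maxGenEigenspace] at hx ⊢
  obtain ⟨k, hk⟩ := hx
  refine ⟨k, ?_⟩
  have key : ∀ (k : ℕ) (x : E), ((L' - (μ + δ) • (1 : Module.End ℂ F)) ^ k) (A x)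
      = A (((L - μ • (1 : Module.End ℂ E)) ^ k) x) := by
    intro k
    induction k with
    | zero => intro x; simp
    | succ k ih =>
      intro x
      rw [pow_succ, pow_succ, Module.End.mul_apply, Module.End.mul_apply, ← ih]
      congr 1
      simp only [LinearMap.sub_apply, LinearMap.add_apply, LinearMap.smul_apply,
        Module.End.one_apply, map_sub, map_smul, hA, add_smul]
      abel
  rw [key, hk, map_zero]

/-- An invariant subspace containing a sum of generalized eigenvectors for distinct eigenvalues
contains each summand. -/
lemma mem_of_sum_mem_of_mem_maxGenEigenspace (L : Module.End ℂ E) (P : Submodule ℂ E)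
    (hP : P ≤ P.comap L) (s : Finset ℂ) (x : ℂ → E)
    (hx : ∀ μ ∈ s, x μ ∈ L.maxGenEigenspace μ) (h : ∑ μ ∈ s, x μ ∈ P) : ∀ μ ∈ s, x μ ∈ P := by
  intro μ hμ
  -- Modulo `P` the summands are generalized eigenvectors of the induced operator with sum zero, so
  -- independence kills each of them.
  rw [← Submodule.Quotient.mk_eq_zero, ← Submodule.mkQ_apply]
  refine (Module.End.independent_maxGenEigenspace (P.mapQ P L hP)).eq_zero_of_sum_eq_zero s
    (fun μ => P.mkQ (x μ)) (fun μ hμ => ?_) ?_ μ hμ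
  · have := map_mem_maxGenEigenspace_add L (P.mapQ P L hP) P.mkQ 0 (by simp) μ (hx μ hμ)
    rwa [add_zero] at this
  · rw [← map_sum, Submodule.mkQ_apply, Submodule.Quotient.mk_eq_zero]
    exact h

/-- Eigenspace decomposition for an operator of finite order. -/
lemma le_iSup_eigenspace_of_pow_eq_one (φ : Module.End ℂ E) {T : ℕ} (hT : 0 < T) (hφ : φ ^ T = 1)
    (S : Submodule ℂ E) (hS : ∀ x ∈ S, φ x ∈ S) :
    S ≤ ⨆ (r : ℕ) (_ : r < T),
      Module.End.eigenspace φ (exp (-(2 * Real.pi * I * (r / T : ℂ)))) ⊓ S := by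
  intro x hx
  have hT' : (T : ℂ) ≠ 0 := Nat.cast_ne_zero.mpr hT.ne'
  set ζ : ℂ := exp (2 * Real.pi * I / T) with hζ
  have hprim : IsPrimitiveRoot ζ T := Complex.isPrimitiveRoot_exp T hT.ne'
  have hζ0 : ζ ≠ 0 := exp_ne_zero _
  -- Unnormalized Fourier projections: `φ (p r) = ζ⁻ʳ p r`, and orthogonality of characters gives `∑
  -- p r = T x`.
  set p : ℕ → E := fun r => ∑ j ∈ Finset.range T, (ζ ^ r) ^ j • (φ ^ j) x with hp
  have hpow : ∀ j, (φ ^ j) x ∈ S := by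
    intro j
    induction j with
    | zero => simpa
    | succ j ih => rw [pow_succ', Module.End.mul_apply]; exact hS _ ih
  have hmem : ∀ r : ℕ, p r ∈ Module.End.eigenspace φ (exp (-(2 * Real.pi * I * (r / T : ℂ)))) ⊓ S := by
    intro r
    refine ⟨?_, Submodule.sum_mem _ fun j _ => Submodule.smul_mem _ _ (hpow j)⟩
    rw [SetLike.mem_coe, Module.End.mem_eigenspace_iff]
    have he : exp (-(2 * Real.pi * I * (r / T : ℂ))) = (ζ ^ r)⁻¹ := by
      rw [hζ, ← exp_nat_mul, ← exp_neg]; congr 1; ring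
    rw [he, eq_inv_smul_iff₀ (pow_ne_zero _ hζ0)]
    have h1 : ζ ^ r • φ (p r) = ∑ j ∈ Finset.range T, (ζ ^ r) ^ (j + 1) • (φ ^ (j + 1)) x := by
      rw [hp, map_sum, Finset.smul_sum]
      refine Finset.sum_congr rfl fun j _ => ?_
      rw [map_smul, smul_smul, pow_succ' φ, pow_succ' (ζ ^ r), Module.End.mul_apply]
    have h2 := Finset.sum_range_succ (fun j => (ζ ^ r) ^ j • (φ ^ j) x) T
    rw [Finset.sum_range_succ', hφ, show (ζ ^ r) ^ T = 1 by
      rw [← pow_mul, mul_comm, pow_mul, hprim.pow_eq_one, one_pow], pow_zero, pow_zero] at h2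
    rw [h1]
    exact add_right_cancel h2
  have hsum : ∑ r ∈ Finset.range T, p r = (T : ℂ) • x := by
    simp only [hp]
    rw [Finset.sum_comm]
    rw [Finset.sum_eq_single_of_mem 0 (Finset.mem_range.mpr hT)]
    · simp [← Nat.cast_smul_eq_nsmul ℂ]
    · intro j hj hj0
      rw [← Finset.sum_smul]
      have : ∑ r ∈ Finset.range T, (ζ ^ r) ^ j = 0 := by
        have hz : ζ ^ j ≠ 1 := hprim.pow_ne_one_of_pos_of_lt hj0 (Finset.mem_range.mp hj)
        have hg := mul_geom_sum (ζ ^ j) T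
        rw [← pow_mul, mul_comm j T, pow_mul, hprim.pow_eq_one, one_pow, sub_self] at hg
        rw [← (mul_eq_zero.mp hg).resolve_left (sub_ne_zero.mpr hz)]
        exact Finset.sum_congr rfl fun r _ => by rw [← pow_mul, ← pow_mul, mul_comm]
      rw [this, zero_smul]
  have : x = (T : ℂ)⁻¹ • ∑ r ∈ Finset.range T, p r := by rw [hsum, inv_smul_smul₀ hT']
  rw [this]
  refine Submodule.smul_mem _ _ (Submodule.sum_mem _ fun r hr => ?_)
  exact Submodule.mem_iSup_of_mem r (Submodule.mem_iSup_of_mem (Finset.mem_range.mp hr) (hmem r))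

end LinearAlgebra

/-! ### Weights and automorphism eigenspaces in `V`. -/

namespace VertexOperatorAlgebra

variable {V : Type u} [AddCommGroup V] [Module ℂ V] [VertexOperatorAlgebra V]

lemma mem_weight {a : V} {n : ℤ} : a ∈ weight V n ↔ mode 1 conformal a = (n : ℂ) • a :=
  Module.End.mem_eigenspace_iff

lemma mem_eigen {g : Aut V} {r : ℕ} {a : V} :
    a ∈ eigen g r ↔ (g : V ≃ₗ[ℂ] V) a = exp (-(2 * Real.pi * I * (r / orderOf g : ℂ))) • a :=
  Module.End.mem_eigenspace_iff

lemma translation_mem_weight {a : V} {n : ℤ} (ha : a ∈ weight V n) :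
    mode 0 conformal a ∈ weight V (n + 1) := by
  rw [mem_weight] at ha ⊢
  have h := virasoro (V := V) 0 (-1) a
  simp only [zero_add, neg_add_cancel, ha, map_smul] at h
  rw [sub_eq_iff_eq_add] at h
  rw [h]
  simp [add_smul, add_comm]

lemma translation_mem_eigen {g : Aut V} {r : ℕ} {a : V} (ha : a ∈ eigen g r) :
    mode 0 conformal a ∈ eigen g r := by
  rw [mem_eigen] at ha ⊢
  rw [g.2.1, g.2.2.2, ha, map_smul]

lemma conformal_mem_eigen (g : Aut V) : (conformal : V) ∈ eigen g 0 := by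
  rw [mem_eigen, g.2.2.2]; simp

lemma mode_neg_two_vacuum (a : V) : mode (-2) a vacuum = mode 0 conformal a := by
  have h := derivative (V := V) (-1) a vacuum
  rw [creation] at h
  simpa using h.symm

lemma map_mem_weight (g : Aut V) {a : V} {n : ℤ} (ha : a ∈ weight V n) :
    (g : V ≃ₗ[ℂ] V) a ∈ weight V n := by
  rw [mem_weight] at ha ⊢
  have h := g.2.1 1 conformal a
  rw [g.2.2.2, ha, map_smul] at h
  exact h.symm

lemma map_mem_eigen {g h : Aut V} (hgh : Commute g h) {a : V} {r : ℕ} (ha : a ∈ eigen g r) :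
    (h : V ≃ₗ[ℂ] V) a ∈ eigen g r := by
  rw [mem_eigen] at ha ⊢
  have : (g : V ≃ₗ[ℂ] V) ((h : V ≃ₗ[ℂ] V) a) = (h : V ≃ₗ[ℂ] V) ((g : V ≃ₗ[ℂ] V) a) := by
    have h1 := congrArg (fun k : Aut V => (k : V ≃ₗ[ℂ] V) a) hgh.eq
    exact h1
  rw [this, ha, map_smul]

lemma le_iSup_eigen_inf {g : Aut V} (hg : IsOfFinOrder g) (S : Submodule ℂ V)
    (hS : ∀ a ∈ S, (g : V ≃ₗ[ℂ] V) a ∈ S) :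
    S ≤ ⨆ (r : ℕ) (_ : r < orderOf g), eigen g r ⊓ S := by
  refine le_iSup_eigenspace_of_pow_eq_one _ hg.orderOf_pos ?_ S hS
  have h1 : ∀ k : ℕ, (((g : V ≃ₗ[ℂ] V) : V →ₗ[ℂ] V)) ^ k
      = (((g ^ k : Aut V) : V ≃ₗ[ℂ] V) : V →ₗ[ℂ] V) := by
    intro k
    induction k with
    | zero => rfl
    | succ k ih => rw [pow_succ, pow_succ, ih]; rfl
  rw [h1, pow_orderOf_eq_one]
  rfl

/-- A subspace that is stable under `g₁` and `g₂` is spanned by its common eigenvectors. -/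
lemma le_iSup_eigen_inf_eigen_inf {g₁ g₂ : Aut V} (hcomm : Commute g₁ g₂) (hg₁ : IsOfFinOrder g₁)
    (hg₂ : IsOfFinOrder g₂) (S : Submodule ℂ V) (hS₁ : ∀ a ∈ S, (g₁ : V ≃ₗ[ℂ] V) a ∈ S)
    (hS₂ : ∀ a ∈ S, (g₂ : V ≃ₗ[ℂ] V) a ∈ S) :
    S ≤ ⨆ (r₁ : ℕ) (_ : r₁ < orderOf g₁) (r₂ : ℕ) (_ : r₂ < orderOf g₂),
      eigen g₁ r₁ ⊓ eigen g₂ r₂ ⊓ S := by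
  refine (le_iSup_eigen_inf hg₁ S hS₁).trans (iSup₂_mono fun r₁ _ => ?_)
  refine (le_iSup_eigen_inf hg₂ (eigen g₁ r₁ ⊓ S)
    fun a ha => ⟨map_mem_eigen hcomm ha.1, hS₂ a ha.2⟩).trans (iSup₂_mono fun r₂ _ => ?_)
  exact le_of_eq (by rw [inf_left_comm, inf_assoc])

/-- A common eigenvector for `g₁`, `g₂` is an eigenvector for `g₁ g₂`, with the fractions added
modulo `1`. -/
lemma exists_twist_mul {g₁ g₂ : Aut V} (hcomm : Commute g₁ g₂) (hg₁ : IsOfFinOrder g₁)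
    (hg₂ : IsOfFinOrder g₂) {r₁ r₂ : ℕ} {a : V}
    (ha : a ∈ eigen g₁ r₁ ⊓ eigen g₂ r₂) (ha0 : a ≠ 0) :
    ∃ r₃ < orderOf (g₁ * g₂), a ∈ eigen (g₁ * g₂) r₃ ∧
      ∃ ε : ℕ, twist g₁ r₁ + twist g₂ r₂ = twist (g₁ * g₂) r₃ + ε ∧
        (ε = 0 → r₃ = 0 → r₁ = 0 ∧ r₂ = 0) := by
  have hg₃ : IsOfFinOrder (g₁ * g₂) := hcomm.isOfFinOrder_mul hg₁ hg₂
  set T := orderOf (g₁ * g₂) with hT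
  have hT0 : 0 < T := hg₃.orderOf_pos
  have hTC : (T : ℂ) ≠ 0 := Nat.cast_ne_zero.mpr hT0.ne'
  have hmul : ((g₁ * g₂ : Aut V) : V ≃ₗ[ℂ] V) a
      = exp (-(2 * Real.pi * I * (twist g₁ r₁ + twist g₂ r₂))) • a := by
    change (g₁ : V ≃ₗ[ℂ] V) ((g₂ : V ≃ₗ[ℂ] V) a) = _
    rw [mem_eigen.mp ha.2, map_smul, mem_eigen.mp ha.1, smul_smul, ← exp_add]
    congr 2
    simp only [twist]; ring
  have hpow : ∀ k : ℕ, (((g₁ * g₂) ^ k : Aut V) : V ≃ₗ[ℂ] V) a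
      = exp (-(2 * Real.pi * I * (k * (twist g₁ r₁ + twist g₂ r₂)))) • a := by
    intro k
    induction k with
    | zero => simp
    | succ k ih =>
      rw [pow_succ']
      change ((g₁ * g₂ : Aut V) : V ≃ₗ[ℂ] V) ((((g₁ * g₂) ^ k : Aut V) : V ≃ₗ[ℂ] V) a) = _
      rw [ih, map_smul, hmul, smul_smul, ← exp_add]
      congr 2
      push_cast; ring
  have h1 := hpow T
  rw [pow_orderOf_eq_one] at h1
  -- This is where `a ≠ 0` matters: it forces `T(α + β)` to be an integer.
  have h2 : exp (-(2 * Real.pi * I * (T * (twist g₁ r₁ + twist g₂ r₂)))) = 1 := by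
    by_contra hne
    refine ha0 ((smul_eq_zero.mp (?_ :
      (exp (-(2 * Real.pi * I * (T * (twist g₁ r₁ + twist g₂ r₂)))) - 1) • a = 0)).resolve_left
      (sub_ne_zero.mpr hne))
    rw [sub_smul, one_smul, ← h1, sub_eq_zero]
    rfl
  obtain ⟨z, hz⟩ := Complex.exp_eq_one_iff.mp h2
  have h3 : (T : ℂ) * (twist g₁ r₁ + twist g₂ r₂) = ((-z : ℤ) : ℂ) := by
    have hne : (2 * Real.pi * I : ℂ) ≠ 0 := Complex.two_pi_I_ne_zero
    apply mul_left_cancel₀ hne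
    push_cast
    linear_combination -hz
  have hreal : twist g₁ r₁ + twist g₂ r₂
      = (((r₁ : ℝ) / orderOf g₁ + (r₂ : ℝ) / orderOf g₂ : ℝ) : ℂ) := by
    simp only [twist]; push_cast; ring
  have hnn : 0 ≤ -z := by
    have h4 : (T : ℝ) * ((r₁ : ℝ) / orderOf g₁ + (r₂ : ℝ) / orderOf g₂) = ((-z : ℤ) : ℝ) := by
      rw [hreal] at h3; exact_mod_cast h3
    have h5 : (0 : ℝ) ≤ ((-z : ℤ) : ℝ) := by rw [← h4]; positivity
    exact_mod_cast h5
  -- Now `α + β = N / T` with `N ≥ 0`: the remainder of `N` modulo `T` is `r₃` and the quotient is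
  -- the carry `ε`. Both vanish only if `α + β = 0`, hence `α = β = 0`.
  obtain ⟨N, hN⟩ := Int.eq_ofNat_of_zero_le hnn
  rw [hN, Int.cast_natCast] at h3
  have h6 : twist g₁ r₁ + twist g₂ r₂ = twist (g₁ * g₂) (N % T) + (N / T : ℕ) := by
    simp only [twist, ← hT] at h3 ⊢
    have h7 : (N : ℂ) = (N % T : ℕ) + T * (N / T : ℕ) := by
      exact_mod_cast (Nat.mod_add_div N T).symm
    rw [h7] at h3
    field_simp at h3 ⊢
    linear_combination h3
  refine ⟨N % T, Nat.mod_lt _ hT0, ?_, N / T, h6, fun hε hr => ?_⟩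
  · rw [mem_eigen, hmul, h6]
    congr 1
    rw [mul_add, neg_add, exp_add]
    have : exp (-(2 * Real.pi * I * ((N / T : ℕ) : ℂ))) = 1 :=
      Complex.exp_eq_one_iff.mpr ⟨-((N / T : ℕ) : ℤ), by
        rw [Int.cast_neg, Int.cast_natCast]; ring⟩
    rw [this, mul_one]
    rfl
  · rw [hε, hr, hreal] at h6
    have h8 : (r₁ : ℝ) / orderOf g₁ + (r₂ : ℝ) / orderOf g₂ = 0 := by
      have : (((r₁ : ℝ) / orderOf g₁ + (r₂ : ℝ) / orderOf g₂ : ℝ) : ℂ) = 0 := by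
        rw [h6]; simp [twist]
      exact_mod_cast this
    have h9 := (add_eq_zero_iff_of_nonneg (by positivity) (by positivity)).mp h8
    have hp₁ : (orderOf g₁ : ℝ) ≠ 0 := Nat.cast_ne_zero.mpr hg₁.orderOf_pos.ne'
    have hp₂ : (orderOf g₂ : ℝ) ≠ 0 := Nat.cast_ne_zero.mpr hg₂.orderOf_pos.ne'
    exact ⟨by simpa [hp₁] using h9.1, by simpa [hp₂] using h9.2⟩

end VertexOperatorAlgebra

open VertexOperatorAlgebra

section

variable {V : Type u} [AddCommGroup V] [Module ℂ V] [VertexOperatorAlgebra V]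

@[simp]
lemma twist_zero (g : Aut V) : twist g 0 = 0 := by simp [twist]

lemma choose_zero_of_ne {i : ℕ} (hi : i ≠ 0) : Ring.choose (0 : ℂ) i = 0 :=
  Ring.choose_zero_pos ℂ (Nat.pos_of_ne_zero hi)

lemma choose_one_of_two_le {i : ℕ} (hi : 2 ≤ i) : Ring.choose (1 : ℂ) i = 0 := by
  have := Ring.choose_natCast (R := ℂ) 1 i
  rw [Nat.cast_one] at this
  rw [this, Nat.choose_eq_zero_of_lt hi, Nat.cast_zero]

lemma finsum_eq_sum_range {E : Type*} [AddCommMonoid E] {N : ℕ} (f : ℕ → E)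
    (h : ∀ i, N ≤ i → f i = 0) : ∑ᶠ i, f i = ∑ i ∈ Finset.range N, f i := by
  refine finsum_eq_sum_of_support_subset f fun i hi => ?_
  rw [Finset.coe_range, Set.mem_Iio]
  by_contra! hlt
  exact hi (h i hlt)

lemma finsum_eq_add_of_two_le {E : Type*} [AddCommMonoid E] (f : ℕ → E)
    (h : ∀ i, 2 ≤ i → f i = 0) : ∑ᶠ i, f i = f 0 + f 1 := by
  rw [finsum_eq_sum_range f h, Finset.sum_range_succ, Finset.sum_range_one]

/-! ### Twisted modules: the `L(0)`-grading and `C₁(W)`. -/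

namespace WeakTwistedModule

variable {g : Aut V} {W : Type v} [AddCommGroup W] [Module ℂ W] (M : WeakTwistedModule g W)

/-- `Y_W(L(-1) a, x) = d/dx Y_W(a, x)`. -/
lemma mode_translation {r : ℕ} (hr : r < orderOf g) {a : V} (ha : a ∈ eigen g r) (n : ℂ) (w : W) :
    M.mode n (VertexOperatorAlgebra.mode 0 conformal a) w = (-n) • M.mode (n - 1) a w := by
  by_cases hn : ∃ m : ℤ, n = m - twist g r
  · obtain ⟨m, rfl⟩ := hn
    -- With `b = 𝟏`, `n = -2`, `h = 0`, the mode `𝟏₋₁` never occurs on the left, so that side is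
    -- zero. On the right only `a₋₂𝟏 = L(-1)a` and `a₋₁𝟏 = a` survive.
    have h := M.jacobi r hr a ha vacuum w (-2) m 0
    have e1 : ∀ i : ℕ, M.mode (0 + (i : ℂ)) vacuum w = 0 := by
      intro i
      rw [M.vacuum_mode, if_neg]
      intro h0
      have : ((i : ℤ) : ℂ) = ((-1 : ℤ) : ℂ) := by push_cast; linear_combination h0
      have := Int.cast_injective this
      omega
    have e2 : ∀ (i : ℕ) (x : W), M.mode (0 + ((-2 : ℤ) : ℂ) - i) vacuum x = 0 := by
      intro i x
      rw [M.vacuum_mode, if_neg]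
      intro h0
      have : ((-2 - i : ℤ) : ℂ) = ((-1 : ℤ) : ℂ) := by push_cast at h0 ⊢; linear_combination h0
      have := Int.cast_injective this
      omega
    simp only [e1, e2, map_zero, smul_zero, finsum_zero, sub_zero] at h
    rw [finsum_eq_add_of_two_le] at h
    · rw [Ring.choose_zero_right, Ring.choose_one_right, one_smul,
        show (-2 + ((0 : ℕ) : ℤ)) = -2 from rfl, show (-2 + ((1 : ℕ) : ℤ)) = -1 from rfl,
        creation, mode_neg_two_vacuum, Nat.cast_zero, sub_zero, zero_add, Nat.cast_one] at h
      rw [neg_smul]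
      exact eq_neg_of_add_eq_zero_left h.symm
    · intro i hi
      obtain ⟨j, rfl⟩ := Nat.exists_eq_add_of_le hi
      rw [show (-2 + ((2 + j : ℕ) : ℤ)) = (j : ℤ) by push_cast; ring, creation_nonneg, map_zero,
        LinearMap.zero_apply, smul_zero]
  · rw [M.twist_support r hr _ (translation_mem_eigen ha) w n hn,
      M.twist_support r hr _ ha w (n - 1), smul_zero]
    rintro ⟨k, hk⟩
    exact hn ⟨k + 1, by push_cast; linear_combination hk⟩

/-- The commutator of `L(0)` with a mode. -/
lemma L0_mode (hg : IsOfFinOrder g) (h : ℂ) (b : V) (w : W) :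
    M.mode 1 conformal (M.mode h b w) = M.mode h b (M.mode 1 conformal w)
      + (M.mode (h + 1) (VertexOperatorAlgebra.mode 0 conformal b) w
        + M.mode h (VertexOperatorAlgebra.mode 1 conformal b) w) := by
  -- The choice `n = 0`, `m = 1` cuts the left sums to one term each and the right sum to the terms
  -- `ω₀ b` and `ω₁ b`.
  have hj := M.jacobi 0 hg.orderOf_pos conformal (conformal_mem_eigen g) b w 0 1 h
  rw [finsum_eq_single _ 0 fun i hi => by rw [Int.cast_zero, choose_zero_of_ne hi]; simp,
    finsum_eq_single _ 0 fun i hi => by rw [Int.cast_zero, choose_zero_of_ne hi]; simp,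
    finsum_eq_add_of_two_le _ fun i hi => by
      rw [twist_zero, Int.cast_one, sub_zero, choose_one_of_two_le hi, zero_smul]] at hj
  simp only [Ring.choose_zero_right, Ring.choose_one_right, twist_zero, Int.cast_one, sub_zero,
    Int.cast_zero, pow_zero, one_mul, zpow_zero, one_smul, Nat.cast_zero, add_zero, zero_add,
    Nat.cast_one, add_sub_cancel_right, sub_self] at hj
  rw [sub_eq_iff_eq_add] at hj
  rw [hj, add_comm]

lemma mode_mem_weightSpace (hg : IsOfFinOrder g) {r : ℕ} (hr : r < orderOf g) {a : V} {n : ℤ}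
    (ha : a ∈ eigen g r ⊓ weight V n) (s : ℂ) {c : ℂ} {w : W} (hw : w ∈ M.weightSpace c) :
    M.mode s a w ∈ M.weightSpace (c + (n - s - 1)) := by
  refine map_mem_maxGenEigenspace_add (M.mode 1 conformal) (M.mode 1 conformal) (M.mode s a) _
    (fun x => ?_) c hw
  rw [M.L0_mode hg, M.mode_translation hr ha.1, mem_weight.mp ha.2, map_smul,
    LinearMap.smul_apply, add_sub_cancel_right, ← add_smul]
  congr 2
  ring

/-- The modes `a_{-1-r/T-k}` map into `C₁(W)`. -/
lemma mode_mem_C1 {r : ℕ} (hr : r < orderOf g) (k : ℕ) {a : V} {n : ℤ}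
    (ha : a ∈ eigen g r ⊓ weight V n) (hn : 0 ≤ n) (hnk : 0 < n ∨ 0 < r ∨ 0 < k) (w : W) :
    M.mode (-1 - twist g r - k) a w ∈ M.C1 := by
  have base : ∀ {a : V} {n : ℤ}, a ∈ eigen g r ⊓ weight V n → 0 ≤ n → 0 < n ∨ 0 < r →
      M.mode (-1 - twist g r) a w ∈ M.C1 := by
    intro a n ha hn h
    by_cases hr0 : r = 0
    · subst hr0
      refine Submodule.mem_sup_left (Submodule.subset_span ⟨n, by simpa using h, a, ha, w, ?_⟩)
      rw [twist_zero, sub_zero]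
    · exact Submodule.mem_sup_right (Submodule.subset_span
        ⟨r, Nat.one_le_iff_ne_zero.mpr hr0, hr, n, hn, a, ha, w, rfl⟩)
  induction k generalizing a n with
  | zero => simpa using base ha hn (by simpa using hnk)
  | succ k ih =>
    -- `(L(-1)a)_s` is a nonzero multiple of `a_{s-1}`. Passing to `L(-1)a` also makes the weight
    -- positive, so weight zero is harmless once `k > 0`.
    have h1 := ih (a := VertexOperatorAlgebra.mode 0 conformal a) (n := n + 1)
      ⟨translation_mem_eigen ha.1, translation_mem_weight ha.2⟩ (by omega) (Or.inl (by omega))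
    rw [M.mode_translation hr ha.1] at h1
    have hne : -(-1 - twist g r - k) ≠ 0 := by
      intro h0
      have h2 : ((1 + (r : ℝ) / orderOf g + k : ℝ) : ℂ) = 0 := by
        simp only [twist] at h0; push_cast; linear_combination h0
      have h3 : (0 : ℝ) < 1 + (r : ℝ) / orderOf g + k := by positivity
      exact h3.ne' (by exact_mod_cast h2)
    rw [Submodule.smul_mem_iff _ hne] at h1
    rwa [show -1 - twist g r - (k + 1 : ℕ) = -1 - twist g r - k - 1 by push_cast; ring]

lemma exists_mode_eq_zero {r : ℕ} (hr : r < orderOf g) {a : V} (ha : a ∈ eigen g r) (n : ℤ)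
    (w : W) : ∃ N : ℕ, ∀ i : ℕ, N ≤ i → M.mode (n - twist g r + i) a w = 0 := by
  obtain ⟨N, hN⟩ := M.truncation r hr a ha w
  refine ⟨(N - n).toNat, fun i hi => ?_⟩
  rw [show (n : ℂ) - twist g r + i = ((n + i : ℤ) : ℂ) - twist g r by push_cast; ring]
  exact hN _ (by omega)

lemma iSup_weightSpace (hM : M.IsGeneralized) : ⨆ c, M.weightSpace c = ⊤ :=
  hM.decomposition.submodule_iSup_eq_top

lemma iSupIndep_weightSpace : iSupIndep M.weightSpace :=
  Module.End.independent_maxGenEigenspace _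

/-- The part of weight `c` of the obvious spanning set of `C₁(W)`. -/
def C1Weight (c : ℂ) : Submodule ℂ W :=
  Submodule.span ℂ {x | ∃ r < orderOf g, ∃ n : ℤ, 0 ≤ n ∧ (0 < n ∨ 0 < r) ∧
    ∃ a ∈ eigen g r ⊓ weight V n, ∃ w ∈ M.weightSpace (c - n - twist g r),
      x = M.mode (-1 - twist g r) a w}

lemma C1Weight_le_weightSpace (hg : IsOfFinOrder g) (c : ℂ) :
    M.C1Weight c ≤ M.weightSpace c := by
  refine Submodule.span_le.mpr ?_
  rintro _ ⟨r, hr, n, -, -, a, ha, w, hw, rfl⟩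
  have := M.mode_mem_weightSpace hg hr ha (-1 - twist g r) hw
  rwa [show c - n - twist g r + (n - (-1 - twist g r) - 1) = c by ring] at this

lemma C1Weight_le_C1 (c : ℂ) : M.C1Weight c ≤ M.C1 := by
  refine Submodule.span_le.mpr ?_
  rintro _ ⟨r, hr, n, hn, h, a, ha, w, -, rfl⟩
  simpa using M.mode_mem_C1 hr 0 ha hn (by tauto) w

lemma mode_mem_iSup_C1Weight (hM : M.IsGeneralized) {r : ℕ} (hr : r < orderOf g) {a : V} {n : ℤ}
    (ha : a ∈ eigen g r ⊓ weight V n) (hn : 0 ≤ n) (h : 0 < n ∨ 0 < r) (w : W) :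
    M.mode (-1 - twist g r) a w ∈ ⨆ c, M.C1Weight c := by
  have hw : w ∈ ⨆ c, M.weightSpace c := by rw [M.iSup_weightSpace hM]; trivial
  refine Submodule.iSup_induction _ (motive := fun w => M.mode (-1 - twist g r) a w ∈ _) hw
    (fun c x hx => ?_) (by simp) (fun x y hx hy => by rw [map_add]; exact add_mem hx hy)
  refine Submodule.mem_iSup_of_mem (c + n + twist g r) (Submodule.subset_span
    ⟨r, hr, n, hn, h, a, ha, x, ?_, rfl⟩)
  rwa [show c + n + twist g r - n - twist g r = c by ring]

/-- The generators of `C₁(W)` may be taken with homogeneous `w`, because `W` is the sum of its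
weight spaces; hence `C₁(W)` is graded. -/
lemma C1_le_iSup_C1Weight (hg : IsOfFinOrder g) (hM : M.IsGeneralized) :
    M.C1 ≤ ⨆ c, M.C1Weight c := by
  refine sup_le (Submodule.span_le.mpr ?_) (Submodule.span_le.mpr ?_)
  · rintro _ ⟨n, hn, a, ha, w, rfl⟩
    simpa using M.mode_mem_iSup_C1Weight hM hg.orderOf_pos ha hn.le (Or.inl hn) w
  · rintro _ ⟨r, h1, hr, n, hn, a, ha, w, rfl⟩
    exact M.mode_mem_iSup_C1Weight hM hr ha hn (Or.inr h1) w

/-- A homogeneous family representing a basis of `W / C₁(W)`. -/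
lemma exists_homogeneous_basis (hg : IsOfFinOrder g) (hM : M.IsGeneralized)
    (hC : M.IsC1Cofinite) :
    ∃ u : Fin (Module.finrank ℂ (W ⧸ M.C1)) → W, ∀ c,
      M.weightSpace c ≤ Submodule.span ℂ (Set.range u) ⊔ M.C1Weight c := by
  have := hC
  unfold IsC1Cofinite at this
  -- Classes of homogeneous vectors span the quotient, so a basis can be chosen among them.
  set S : Set (W ⧸ M.C1) := {x | ∃ c, ∃ w ∈ M.weightSpace c, x = M.C1.mkQ w} with hS
  have hspan : ⊤ ≤ Submodule.span ℂ S := by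
    rw [← M.C1.range_mkQ, LinearMap.range_eq_map, ← M.iSup_weightSpace hM, Submodule.map_iSup]
    refine iSup_le fun c => ?_
    rintro _ ⟨w, hw, rfl⟩
    exact Submodule.subset_span ⟨c, w, hw, rfl⟩
  set b := Module.Basis.ofSpan hspan with hb
  have := Module.Finite.finite_basis b
  have := Fintype.ofFinite ((linearIndepOn_empty ℂ (id : (W ⧸ M.C1) → _)).extend
    (Set.empty_subset S))
  have hfin := Module.finrank_eq_card_basis b
  set b' := b.reindex (Fintype.equivFinOfCardEq hfin.symm) with hb'
  have hmem : ∀ i, ∃ c, ∃ w ∈ M.weightSpace c, b' i = M.C1.mkQ w := by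
    intro i
    rw [hb', Module.Basis.reindex_apply]
    exact Module.Basis.ofSpan_subset hspan ⟨_, rfl⟩
  choose d u hu hbu using hmem
  refine ⟨u, fun c => ?_⟩
  set U : ℂ → Submodule ℂ W := fun c => Submodule.span ℂ {x | ∃ i, d i = c ∧ x = u i} with hU
  have hUle : ∀ c, U c ⊔ M.C1Weight c ≤ M.weightSpace c := by
    refine fun c => sup_le (Submodule.span_le.mpr ?_) (M.C1Weight_le_weightSpace hg c)
    rintro _ ⟨i, rfl, rfl⟩
    exact hu i
  have htop : ⨆ c, (U c ⊔ M.C1Weight c) = ⊤ := by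
    rw [eq_top_iff]
    intro x _
    have h1 : ∑ i, b'.repr (M.C1.mkQ x) i • u i ∈ ⨆ c, (U c ⊔ M.C1Weight c) :=
      Submodule.sum_mem _ fun i _ => Submodule.smul_mem _ _ (Submodule.mem_iSup_of_mem (d i)
        (Submodule.mem_sup_left (Submodule.subset_span ⟨i, rfl, rfl⟩)))
    have h2 : x - ∑ i, b'.repr (M.C1.mkQ x) i • u i ∈ M.C1 := by
      rw [← Submodule.Quotient.mk_eq_zero, ← Submodule.mkQ_apply, map_sub, map_sum]
      simp only [map_smul, ← hbu]
      rw [b'.sum_repr, sub_self]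
    have h3 := (M.C1_le_iSup_C1Weight hg hM).trans (iSup_mono fun c =>
      (le_sup_right : _ ≤ U c ⊔ M.C1Weight c)) h2
    simpa using add_mem h3 h1
  -- The graded pieces `U c ⊔ C1Weight c` together fill `W`, so by independence each fills its
  -- weight space.
  have h4 := M.iSupIndep_weightSpace.inf_iSup_le hUle c
  rw [htop, inf_top_eq] at h4
  refine h4.trans (sup_le_sup_right (Submodule.span_mono ?_) _)
  rintro _ ⟨i, -, rfl⟩
  exact ⟨i, rfl⟩

/-- The annihilator of `C₁(W)` in the restricted dual separates the points of `W / C₁(W)`. -/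
lemma mem_C1_of_forall_C1Annihilator (hg : IsOfFinOrder g) (hM : M.IsGeneralized) {x : W}
    (hx : ∀ f ∈ M.C1Annihilator, f x = 0) : x ∈ M.C1 := by
  classical
  -- A functional killing `C₁(W)` and every weight space but one lies in the restricted dual, so it
  -- is available for testing `x` one weight at a time.
  have key : ∀ c, x ∈ M.C1 ⊔ ⨆ (d) (_ : d ≠ c), M.weightSpace d := by
    intro c
    by_contra hc
    obtain ⟨f, hf, hker⟩ := Submodule.exists_le_ker_of_notMem hc
    refine hf (hx f ⟨(Set.finite_singleton c).subset ?_, ?_⟩)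
    · rintro d ⟨w, hw, hne⟩
      by_contra hd
      exact hne (hker (Submodule.mem_sup_right
        (Submodule.mem_iSup_of_mem d (Submodule.mem_iSup_of_mem hd hw))))
    · rw [SetLike.mem_coe, Submodule.mem_dualAnnihilator]
      exact fun w hw => hker (Submodule.mem_sup_left hw)
  have hx' : x ∈ ⨆ c, M.weightSpace c := by rw [M.iSup_weightSpace hM]; trivial
  obtain ⟨y, hy⟩ := (Submodule.mem_iSup_iff_exists_dfinsupp' _ x).mp hx'
  rw [DFinsupp.sum] at hy
  rw [← hy]
  refine Submodule.sum_mem _ fun c hc => M.C1Weight_le_C1 c ?_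
  have hle : M.C1 ⊔ ⨆ (d) (_ : d ≠ c), M.weightSpace d
      ≤ M.C1Weight c ⊔ ⨆ (d) (_ : d ≠ c), M.weightSpace d :=
    sup_le ((M.C1_le_iSup_C1Weight hg hM).trans
      (iSup_le_sup_iSup_ne (M.C1Weight_le_weightSpace hg) c)) le_sup_right
  refine M.iSupIndep_weightSpace.inf_sup_le (M.C1Weight_le_weightSpace hg c) ⟨(y c).2, ?_⟩
  have h1 : (y c : W) = x - ∑ d ∈ y.support.erase c, (y d : W) := by
    rw [← hy, ← Finset.add_sum_erase _ _ hc, add_sub_cancel_right]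
  rw [h1]
  refine sub_mem (hle (key c)) (Submodule.sum_mem _ fun d hd => ?_)
  exact Submodule.mem_sup_right (Submodule.mem_iSup_of_mem d
    (Submodule.mem_iSup_of_mem (Finset.ne_of_mem_erase hd) (y d).2))

/-- Evaluation embeds `W / C₁(W)` into the dual of the annihilator, since the annihilator separates
points. -/
lemma finrank_quotient_C1_le (hg : IsOfFinOrder g) (hM : M.IsGeneralized)
    [FiniteDimensional ℂ M.C1Annihilator] :
    M.IsC1Cofinite ∧ Module.finrank ℂ (W ⧸ M.C1) ≤ Module.finrank ℂ M.C1Annihilator := by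
  set Φ : W →ₗ[ℂ] Module.Dual ℂ M.C1Annihilator :=
    (Module.Dual.eval ℂ W).flip.domRestrict M.C1Annihilator |>.flip with hΦ
  have hker : LinearMap.ker Φ ≤ M.C1 := fun x hx =>
    M.mem_C1_of_forall_C1Annihilator hg hM fun f hf => LinearMap.congr_fun hx ⟨f, hf⟩
  have hle : M.C1 ≤ LinearMap.ker Φ := by
    intro x hx
    ext ⟨f, hf⟩
    exact (Submodule.mem_dualAnnihilator f).mp hf.2 x hx
  have hinj : Function.Injective (M.C1.liftQ Φ hle) := by
    rw [← LinearMap.ker_eq_bot, Submodule.ker_liftQ_eq_bot _ _ _ hker]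
  refine ⟨FiniteDimensional.of_injective _ hinj, ?_⟩
  exact (LinearMap.finrank_le_finrank_of_injective hinj).trans_eq Subspace.dual_finrank_eq

end WeakTwistedModule

/-! ### Intertwining operators: weights of coefficients and specialization at `x = 1`. -/

lemma mem_maxGenEigenspace_of_sub_apply_mem {E : Type*} [AddCommGroup E] [Module ℂ E]
    (L : Module.End ℂ E) (μ : ℂ) {x : E} (hx : L x - μ • x ∈ L.maxGenEigenspace μ) :
    x ∈ L.maxGenEigenspace μ := by
  rw [Module.End.mem_maxGenEigenspace] at hx ⊢
  obtain ⟨k, hk⟩ := hx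
  refine ⟨k + 1, ?_⟩
  rw [pow_succ, Module.End.mul_apply]
  exact hk

namespace TwistedIntertwiningOperator

variable {V : Type u} [AddCommGroup V] [Module ℂ V] [VertexOperatorAlgebra V] {g₁ g₂ : Aut V}
    {W₁ : Type v₁} [AddCommGroup W₁] [Module ℂ W₁]
    {W₂ : Type v₂} [AddCommGroup W₂] [Module ℂ W₂]
    {W₃ : Type v₃} [AddCommGroup W₃] [Module ℂ W₃]
    {M₁ : WeakTwistedModule g₁ W₁} {M₂ : WeakTwistedModule g₂ W₂}
    {M₃ : WeakTwistedModule (g₁ * g₂) W₃} (Y : TwistedIntertwiningOperator M₁ M₂ M₃)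

/-- The commutator of `L(0)` with an intertwining operator. -/
lemma L0_coeff (hg₁ : IsOfFinOrder g₁) (hg₂ : IsOfFinOrder g₂) (h : ℂ) (k : ℕ) (w₁ : W₁)
    (w₂ : W₂) :
    M₃.mode 1 conformal (Y.coeff h k w₁ w₂) = Y.coeff h k w₁ (M₂.mode 1 conformal w₂)
      + (Y.coeff h k (M₁.mode 1 conformal w₁) w₂
        + Y.coeff (h + 1) k (M₁.mode 0 conformal w₁) w₂) := by
  have hj := Y.jacobi 0 0 hg₁.orderOf_pos hg₂.orderOf_pos conformal
    ⟨conformal_mem_eigen g₁, conformal_mem_eigen g₂⟩ w₁ w₂ 0 1 h k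
  simp only [twist_zero, sub_zero, Int.cast_zero, Int.cast_one] at hj
  rw [finsum_eq_single _ 0 fun i hi => by rw [choose_zero_of_ne hi]; simp,
    finsum_eq_single _ 0 fun i hi => by rw [choose_zero_of_ne hi]; simp,
    finsum_eq_add_of_two_le _ fun i hi => by
      rw [choose_one_of_two_le hi, zero_smul]] at hj
  simp only [Ring.choose_zero_right, Ring.choose_one_right, sub_zero, pow_zero, one_mul, mul_zero,
    exp_zero, one_smul, Nat.cast_zero, add_zero, zero_add, Nat.cast_one,
    add_sub_cancel_right] at hj
  rw [sub_eq_iff_eq_add] at hj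
  rw [hj]
  abel

/-- With `μ = c₁ + c₂ - h - 1`, applying `L(0) - μ` to a coefficient gives coefficients with `w₁` or
`w₂` closer to zero under the nilpotent part of `L(0)`, plus one with a higher power of `log x`. The
proof is by induction on both nilpotency orders, and downwards on the power of `log x`, which is
bounded. -/
lemma coeff_mem_weightSpace (hg₁ : IsOfFinOrder g₁) (hg₂ : IsOfFinOrder g₂) {c₁ c₂ : ℂ} {w₁ : W₁}
    {w₂ : W₂} (hw₁ : w₁ ∈ M₁.weightSpace c₁) (hw₂ : w₂ ∈ M₂.weightSpace c₂) (h : ℂ) (k : ℕ) :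
    Y.coeff h k w₁ w₂ ∈ M₃.weightSpace (c₁ + c₂ - h - 1) := by
  obtain ⟨p, hp⟩ := (Module.End.mem_maxGenEigenspace _ _ _).mp hw₁
  obtain ⟨q, hq⟩ := (Module.End.mem_maxGenEigenspace _ _ _).mp hw₂
  clear hw₁ hw₂
  induction p generalizing w₁ w₂ q k with
  | zero => rw [show w₁ = 0 from hp]; simp
  | succ p ihp =>
    induction q generalizing w₂ k with
    | zero => rw [show w₂ = 0 from hq]; simp
    | succ q ihq =>
      have step : ∀ k, Y.coeff h (k + 1) w₁ w₂ ∈ M₃.weightSpace (c₁ + c₂ - h - 1) →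
          Y.coeff h k w₁ w₂ ∈ M₃.weightSpace (c₁ + c₂ - h - 1) := by
        intro k hk
        refine mem_maxGenEigenspace_of_sub_apply_mem _ _ ?_
        have e : M₃.mode 1 conformal (Y.coeff h k w₁ w₂) - (c₁ + c₂ - h - 1) • Y.coeff h k w₁ w₂
            = Y.coeff h k ((M₁.mode 1 conformal - c₁ • (1 : Module.End ℂ W₁)) w₁) w₂
              + Y.coeff h k w₁ ((M₂.mode 1 conformal - c₂ • (1 : Module.End ℂ W₂)) w₂)
              + ((k : ℂ) + 1) • Y.coeff h (k + 1) w₁ w₂ := by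
          rw [Y.L0_coeff hg₁ hg₂, Y.derivative, add_sub_cancel_right]
          simp only [LinearMap.sub_apply, LinearMap.smul_apply, Module.End.one_apply, map_sub,
            map_smul]
          module
        rw [e]
        refine add_mem (add_mem (ihp _ ?_ _ hq) (ihq _ ?_)) (Submodule.smul_mem _ _ hk)
        · rw [pow_succ, Module.End.mul_apply] at hp; exact hp
        · rw [pow_succ, Module.End.mul_apply] at hq; exact hq
      obtain ⟨K, hK⟩ := (Y.log_finite w₁ w₂ h).bddAbove
      have hbig : ∀ j, Y.coeff h (k + j) w₁ w₂ ∈ M₃.weightSpace (c₁ + c₂ - h - 1) →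
          Y.coeff h k w₁ w₂ ∈ M₃.weightSpace (c₁ + c₂ - h - 1) := by
        intro j
        induction j with
        | zero => exact id
        | succ j ih => exact fun hj => ih (step _ hj)
      refine hbig (K + 1) ?_
      have h0 : Y.coeff h (k + (K + 1)) w₁ w₂ = 0 := by
        by_contra hne
        have := hK hne
        omega
      rw [h0]
      exact zero_mem _

/-- The pairing of an element of the restricted dual with `𝒴(w₁, x) w₂` involves only finitely
many powers of `x`. -/
lemma finite_support_pairing (hg₁ : IsOfFinOrder g₁) (hg₂ : IsOfFinOrder g₂)
    (hM₁ : M₁.IsGeneralized) (hM₂ : M₂.IsGeneralized) {f : Module.Dual ℂ W₃}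
    (hf : f ∈ M₃.restrictedDual) (k : ℕ) (w₁ : W₁) (w₂ : W₂) :
    (fun n => f (Y.coeff n k w₁ w₂)).support.Finite := by
  have h₁ : w₁ ∈ ⨆ c, M₁.weightSpace c := by rw [M₁.iSup_weightSpace hM₁]; trivial
  have h₂ : w₂ ∈ ⨆ c, M₂.weightSpace c := by rw [M₂.iSup_weightSpace hM₂]; trivial
  refine Submodule.iSup_induction _
    (motive := fun w₁ => (fun n => f (Y.coeff n k w₁ w₂)).support.Finite) h₁ (fun c₁ x₁ hx₁ => ?_)
    (by simp) fun x y hx hy => (hx.union hy).subset fun n hn => ?_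
  · refine Submodule.iSup_induction _
      (motive := fun w₂ => (fun n => f (Y.coeff n k x₁ w₂)).support.Finite) h₂
      (fun c₂ x₂ hx₂ => ?_) (by simp) fun x y hx hy => (hx.union hy).subset fun n hn => ?_
    · have hf' : {c : ℂ | ∃ w ∈ M₃.weightSpace c, f w ≠ 0}.Finite := hf
      refine (hf'.image fun c => c₁ + c₂ - c - 1).subset fun n hn => ?_
      exact ⟨c₁ + c₂ - n - 1, ⟨_, Y.coeff_mem_weightSpace hg₁ hg₂ hx₁ hx₂ n k, hn⟩, by ring⟩
    · by_contra hcon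
      rw [Set.mem_union, not_or, Function.notMem_support, Function.notMem_support] at hcon
      exact hn (by simp [hcon.1, hcon.2])
  · by_contra hcon
    rw [Set.mem_union, not_or, Function.notMem_support, Function.notMem_support] at hcon
    exact hn (by simp [hcon.1, hcon.2])

/-- The functional `w₁ ⊗ w₂ ↦ ⟨f, 𝒴(w₁, x) w₂⟩|_{x = 1}`, where `log 1 = 0`. -/
def evalOne (hg₁ : IsOfFinOrder g₁) (hg₂ : IsOfFinOrder g₂) (hM₁ : M₁.IsGeneralized)
    (hM₂ : M₂.IsGeneralized) : M₃.restrictedDual →ₗ[ℂ] W₁ →ₗ[ℂ] W₂ →ₗ[ℂ] ℂ where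
  -- `∑ᶠ` defaults to zero on infinite support, so additivity rests on `finite_support_pairing`.
  toFun f := LinearMap.mk₂ ℂ (fun w₁ w₂ => ∑ᶠ n, (f : Module.Dual ℂ W₃) (Y.coeff n 0 w₁ w₂))
    (fun x y z => by
      simp only [map_add, LinearMap.add_apply]
      exact finsum_add_distrib (Y.finite_support_pairing hg₁ hg₂ hM₁ hM₂ f.2 0 x z)
        (Y.finite_support_pairing hg₁ hg₂ hM₁ hM₂ f.2 0 y z))
    (fun c x z => by simp only [map_smul, LinearMap.smul_apply, smul_finsum])
    (fun x y z => by
      simp only [map_add]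
      exact finsum_add_distrib (Y.finite_support_pairing hg₁ hg₂ hM₁ hM₂ f.2 0 x y)
        (Y.finite_support_pairing hg₁ hg₂ hM₁ hM₂ f.2 0 x z))
    (fun c x z => by simp only [map_smul, smul_finsum])
  map_add' f f' := by
    ext w₁ w₂
    exact finsum_add_distrib (Y.finite_support_pairing hg₁ hg₂ hM₁ hM₂ f.2 0 w₁ w₂)
        (Y.finite_support_pairing hg₁ hg₂ hM₁ hM₂ f'.2 0 w₁ w₂)
  map_smul' c f := by
    ext w₁ w₂
    exact (smul_finsum c fun n => (f : Module.Dual ℂ W₃) (Y.coeff n 0 w₁ w₂)).symm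

variable (hg₁ : IsOfFinOrder g₁) (hg₂ : IsOfFinOrder g₂) (hM₁ : M₁.IsGeneralized)
    (hM₂ : M₂.IsGeneralized)

lemma evalOne_apply (f : M₃.restrictedDual) (w₁ : W₁) (w₂ : W₂) :
    Y.evalOne hg₁ hg₂ hM₁ hM₂ f w₁ w₂
      = ∑ᶠ n, (f : Module.Dual ℂ W₃) (Y.coeff n 0 w₁ w₂) := rfl

lemma finsum_pairing_add (f : M₃.restrictedDual) (w₁ : W₁) (w₂ : W₂) (d : ℂ) :
    ∑ᶠ n, (f : Module.Dual ℂ W₃) (Y.coeff (n + d) 0 w₁ w₂)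
      = Y.evalOne hg₁ hg₂ hM₁ hM₂ f w₁ w₂ :=
  finsum_comp_equiv (Equiv.addRight d) (f := fun n => (f : Module.Dual ℂ W₃) (Y.coeff n 0 w₁ w₂))

lemma finsum_sum_pairing {N : ℕ} (f : M₃.restrictedDual) (c d : ℕ → ℂ) (x : ℕ → W₁) (y : ℕ → W₂) :
    ∑ᶠ h, ∑ i ∈ Finset.range N, c i * (f : Module.Dual ℂ W₃) (Y.coeff (h + d i) 0 (x i) (y i))
      = ∑ i ∈ Finset.range N, c i * Y.evalOne hg₁ hg₂ hM₁ hM₂ f (x i) (y i) := by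
  rw [finsum_sum_comm]
  · refine Finset.sum_congr rfl fun i _ => ?_
    rw [← Y.finsum_pairing_add hg₁ hg₂ hM₁ hM₂ f _ _ (d i)]
    exact (smul_finsum (c i) _).symm
  · intro i _
    refine ((Y.finite_support_pairing hg₁ hg₂ hM₁ hM₂ f.2 0 (x i) (y i)).preimage
      (Set.injOn_of_injective (add_left_injective (d i)))).subset fun h hh => ?_
    exact right_ne_zero_of_mul hh

/-- The Jacobi identity at `x₂ = 1`, for a functional that kills the first term. -/
lemma evalOne_jacobi {r₁ r₂ : ℕ} (hr₁ : r₁ < orderOf g₁) (hr₂ : r₂ < orderOf g₂) {a : V}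
    (ha : a ∈ eigen g₁ r₁ ⊓ eigen g₂ r₂) (w₁ : W₁) (w₂ : W₂) (n m : ℤ) (f : M₃.restrictedDual)
    (hf : ∀ (i : ℕ) (w : W₃),
      (f : Module.Dual ℂ W₃) (M₃.mode ((n - twist g₁ r₁) + (m - twist g₂ r₂) - i) a w) = 0) :
    ∑ᶠ i : ℕ, Ring.choose (m - twist g₂ r₂) i *
        Y.evalOne hg₁ hg₂ hM₁ hM₂ f (M₁.mode (n - twist g₁ r₁ + i) a w₁) w₂
      = -∑ᶠ i : ℕ, (Ring.choose (n - twist g₁ r₁) i *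
            exp (Real.pi * I * (n - twist g₁ r₁ - i))) *
          Y.evalOne hg₁ hg₂ hM₁ hM₂ f w₁ (M₂.mode (m - twist g₂ r₂ + i) a w₂) := by
  obtain ⟨N₁, hN₁⟩ := M₁.exists_mode_eq_zero hr₁ ha.1 n w₁
  obtain ⟨N₂, hN₂⟩ := M₂.exists_mode_eq_zero hr₂ ha.2 m w₂
  -- The log-free coefficient of each power of `x₂`, paired with `f`. Summing over all `h` sets `x₂
  -- = 1`, and the index shifts then disappear.
  have hj : ∀ h : ℂ, ∑ i ∈ Finset.range N₁, Ring.choose (m - twist g₂ r₂) i *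
        (f : Module.Dual ℂ W₃) (Y.coeff (h + ((m - twist g₂ r₂) - i)) 0
          (M₁.mode (n - twist g₁ r₁ + i) a w₁) w₂)
      = -∑ i ∈ Finset.range N₂, (Ring.choose (n - twist g₁ r₁) i *
            exp (Real.pi * I * (n - twist g₁ r₁ - i))) *
          (f : Module.Dual ℂ W₃) (Y.coeff (h + ((n - twist g₁ r₁) - i)) 0 w₁
            (M₂.mode (m - twist g₂ r₂ + i) a w₂)) := by
    intro h
    have hj := Y.jacobi r₁ r₂ hr₁ hr₂ a ha w₁ w₂ n m h 0
    rw [finsum_eq_sum_range (N := N₁) (fun i : ℕ => Ring.choose (m - twist g₂ r₂) i • _) fun i hi => by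
        rw [hN₁ i hi]; simp,
      finsum_eq_sum_range (N := N₂) (fun i : ℕ => (Ring.choose (n - twist g₁ r₁) i *
            exp (Real.pi * I * (n - twist g₁ r₁ - i))) • _) fun i hi => by
        rw [hN₂ i hi]; simp] at hj
    have hj' := congrArg (f : Module.Dual ℂ W₃) hj
    have hzero : (f : Module.Dual ℂ W₃) (∑ᶠ i : ℕ, ((-1 : ℂ) ^ i *
        Ring.choose (n - twist g₁ r₁) i) • M₃.mode ((n - twist g₁ r₁) + (m - twist g₂ r₂) - i) a
          (Y.coeff (h + i) 0 w₁ w₂)) = 0 := by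
      refine finsum_induction (fun w => (f : Module.Dual ℂ W₃) w = 0) (map_zero _)
        (fun x y hx hy => by rw [map_add, hx, hy, add_zero]) fun i => ?_
      rw [map_smul, hf, smul_zero]
    rw [map_sub, hzero, zero_sub] at hj'
    simp only [map_sum, map_smul, smul_eq_mul, add_sub_assoc] at hj' ⊢
    exact hj'.symm
  rw [finsum_eq_sum_range (N := N₁) _ fun i hi => by rw [hN₁ i hi]; simp,
    finsum_eq_sum_range (N := N₂) _ fun i hi => by rw [hN₂ i hi]; simp,
    ← Y.finsum_sum_pairing hg₁ hg₂ hM₁ hM₂ f _ (fun i : ℕ => (m - twist g₂ r₂) - (i : ℂ)),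
    ← Y.finsum_sum_pairing hg₁ hg₂ hM₁ hM₂ f _ (fun i : ℕ => (n - twist g₁ r₁) - (i : ℂ))
      (fun _ => w₁) _, ← finsum_neg_distrib]
  exact finsum_congr hj

end TwistedIntertwiningOperator

/-! ### Modes landing in `C₁` of a `g₁g₂`-twisted module; functionals composed with `L(0)`. -/

namespace WeakTwistedModule

variable {V : Type u} [AddCommGroup V] [Module ℂ V] [VertexOperatorAlgebra V]

/-- For a common eigenvector `a` of `g₁`, `g₂` with fractions `α`, `β`, the modes
`a_{-1-α-β-i}` of a `g₁g₂`-twisted module map into `C₁`. -/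
lemma mode_mem_C1_of_mul {g₁ g₂ : Aut V} {W : Type v} [AddCommGroup W] [Module ℂ W]
    (M : WeakTwistedModule (g₁ * g₂) W) (hcomm : Commute g₁ g₂) (hg₁ : IsOfFinOrder g₁)
    (hg₂ : IsOfFinOrder g₂) {r₁ r₂ : ℕ} {a : V} {n : ℤ} (ha : a ∈ eigen g₁ r₁ ⊓ eigen g₂ r₂)
    (han : a ∈ weight V n) (hn : 0 ≤ n) (h : 0 < n ∨ 0 < r₁ ∨ 0 < r₂) (i : ℕ) (w : W) :
    M.mode (-1 - twist g₁ r₁ - twist g₂ r₂ - i) a w ∈ M.C1 := by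
  by_cases ha0 : a = 0
  · simp [ha0]
  obtain ⟨r₃, hr₃, ha₃, ε, hε, hε0⟩ := exists_twist_mul hcomm hg₁ hg₂ ha ha0
  rw [show -1 - twist g₁ r₁ - twist g₂ r₂ - i = -1 - twist (g₁ * g₂) r₃ - (ε + i : ℕ) by
    push_cast; linear_combination -hε]
  refine M.mode_mem_C1 hr₃ (ε + i) ⟨ha₃, han⟩ hn ?_ w
  -- The only mode to avoid is `a₋₁` with `a` of weight zero and fixed by `g₁g₂`. It would need `α =
  -- β = 0`, which `h` excludes in weight zero.
  by_cases h1 : ε = 0 ∧ r₃ = 0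
  · have := hε0 h1.1 h1.2
    omega
  · omega

variable {g : Aut V} {W : Type v} [AddCommGroup W] [Module ℂ W] (M : WeakTwistedModule g W)

lemma L0_mem_weightSpace {c : ℂ} {w : W} (hw : w ∈ M.weightSpace c) :
    M.mode 1 conformal w ∈ M.weightSpace c :=
  Module.End.mapsTo_maxGenEigenspace_of_comm (Commute.refl (M.mode 1 conformal)) c hw

lemma comp_L0_mem_restrictedDual {f : Module.Dual ℂ W} (hf : f ∈ M.restrictedDual) :
    f ∘ₗ M.mode 1 conformal ∈ M.restrictedDual := by
  have hf' : {c : ℂ | ∃ w ∈ M.weightSpace c, f w ≠ 0}.Finite := hf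
  refine hf'.subset ?_
  rintro c ⟨w, hw, hne⟩
  exact ⟨_, M.L0_mem_weightSpace hw, hne⟩

end WeakTwistedModule

/-! ### Descent on total weight and injectivity of `f ↦ evalOne f`. -/

namespace TwistedIntertwiningOperator

variable {V : Type u} [AddCommGroup V] [Module ℂ V] [VertexOperatorAlgebra V] {g₁ g₂ : Aut V}
    {W₁ : Type v₁} [AddCommGroup W₁] [Module ℂ W₁]
    {W₂ : Type v₂} [AddCommGroup W₂] [Module ℂ W₂]
    {W₃ : Type v₃} [AddCommGroup W₃] [Module ℂ W₃]
    {M₁ : WeakTwistedModule g₁ W₁} {M₂ : WeakTwistedModule g₂ W₂}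
    {M₃ : WeakTwistedModule (g₁ * g₂) W₃} (Y : TwistedIntertwiningOperator M₁ M₂ M₃)
    (hcomm : Commute g₁ g₂) (hg₁ : IsOfFinOrder g₁) (hg₂ : IsOfFinOrder g₂)
    (hM₁ : M₁.IsGeneralized) (hM₂ : M₂.IsGeneralized)

-- The induction step in the first argument, from the Jacobi identity with `(n, m) = (-1, 0)`. Its
-- leading term is the wanted value, and every other term has smaller total weight. In `H`, total
-- weight is measured in units of `1/(T₁T₂)` so that it becomes an integer.
include hcomm in
lemma evalOne_C1Weight_left (f : M₃.restrictedDual)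
    (hf : (f : Module.Dual ℂ W₃) ∈ M₃.C1.dualAnnihilator) {d₁ d₂ : ℂ}
    (H : ∀ p q : ℤ, orderOf g₂ * p + orderOf g₁ * q < 0 →
      ∀ w₁ ∈ M₁.weightSpace (d₁ + p / orderOf g₁), ∀ w₂ ∈ M₂.weightSpace (d₂ + q / orderOf g₂),
        Y.evalOne hg₁ hg₂ hM₁ hM₂ f w₁ w₂ = 0)
    {x : W₁} (hx : x ∈ M₁.C1Weight d₁) {y : W₂} (hy : y ∈ M₂.weightSpace d₂) :
    Y.evalOne hg₁ hg₂ hM₁ hM₂ f x y = 0 := by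
  have hT₁ : (orderOf g₁ : ℂ) ≠ 0 := Nat.cast_ne_zero.mpr hg₁.orderOf_pos.ne'
  have hT₂ : (orderOf g₂ : ℂ) ≠ 0 := Nat.cast_ne_zero.mpr hg₂.orderOf_pos.ne'
  have hP : (0 : ℤ) < orderOf g₁ * orderOf g₂ := by
    exact_mod_cast Nat.mul_pos hg₁.orderOf_pos hg₂.orderOf_pos
  refine Submodule.span_induction
    (p := fun x _ => Y.evalOne hg₁ hg₂ hM₁ hM₂ f x y = 0) ?_ (by simp)
    (fun a b _ _ ha hb => by rw [map_add, LinearMap.add_apply, ha, hb, add_zero])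
    (fun c a _ ha => by rw [map_smul, LinearMap.smul_apply, ha, smul_zero]) hx
  rintro _ ⟨r₁, hr₁, n, hn, hnr, a, ha, w, hw, rfl⟩
  -- The Jacobi identity needs a common eigenvector, so `a` is split further under `g₂`.
  have ha' := le_iSup_eigen_inf hg₂ (eigen g₁ r₁ ⊓ weight V n)
    (fun b hb => ⟨map_mem_eigen hcomm hb.1, map_mem_weight g₂ hb.2⟩) ha
  clear ha
  refine Submodule.iSup_induction _
    (motive := fun a => Y.evalOne hg₁ hg₂ hM₁ hM₂ f (M₁.mode (-1 - twist g₁ r₁) a w) y = 0) ha'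
    (fun r₂ a ha => ?_) (by simp)
    (fun a b ha hb => by simp only [map_add, LinearMap.add_apply, ha, hb, add_zero])
  by_cases hr₂ : r₂ < orderOf g₂
  swap
  · rw [iSup_neg hr₂, Submodule.mem_bot] at ha
    simp [ha]
  rw [iSup_pos hr₂] at ha
  have hj := Y.evalOne_jacobi hg₁ hg₂ hM₁ hM₂ hr₁ hr₂ ⟨ha.2.1, ha.1⟩ w y (-1) 0 f fun i z => by
    have := M₃.mode_mem_C1_of_mul hcomm hg₁ hg₂ ⟨ha.2.1, ha.1⟩ ha.2.2 hn (by tauto) i z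
    rw [show ((-1 : ℤ) : ℂ) - twist g₁ r₁ + (((0 : ℤ) : ℂ) - twist g₂ r₂) - i
      = -1 - twist g₁ r₁ - twist g₂ r₂ - i by push_cast; ring]
    exact (Submodule.mem_dualAnnihilator _).mp hf _ this
  have hright : ∀ i : ℕ, Y.evalOne hg₁ hg₂ hM₁ hM₂ f w
      (M₂.mode (((0 : ℤ) : ℂ) - twist g₂ r₂ + i) a y) = 0 := by
    intro i
    -- The weights are `d₁ - n - α` and `d₂ + n + β - i - 1`. The total shift `β - α - i - 1` is
    -- negative because `β < 1`.
    refine H (-n * orderOf g₁ - r₁) ((n - i - 1) * orderOf g₂ + r₂) ?_ _ ?_ _ ?_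
    · have h1 : (orderOf g₁ : ℤ) * (r₂ + 1) ≤ orderOf g₁ * orderOf g₂ :=
        mul_le_mul_of_nonneg_left (by exact_mod_cast hr₂) (by positivity)
      have h2 : (0 : ℤ) < orderOf g₁ := by exact_mod_cast hg₁.orderOf_pos
      have h3 : (0 : ℤ) ≤ orderOf g₂ * r₁ := by positivity
      have h4 : (0 : ℤ) ≤ i * (orderOf g₁ * orderOf g₂) := by positivity
      linarith
    · convert hw using 2
      simp only [twist]; push_cast; field_simp; ring
    · convert M₂.mode_mem_weightSpace hg₂ hr₂ ⟨ha.1, ha.2.2⟩ (((0 : ℤ) : ℂ) - twist g₂ r₂ + i) hy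
        using 2
      simp only [twist]; push_cast; field_simp; ring
  have hleft : ∀ i : ℕ, i ≠ 0 → Y.evalOne hg₁ hg₂ hM₁ hM₂ f
      (M₁.mode (((-1 : ℤ) : ℂ) - twist g₁ r₁ + i) a w) y = 0 := by
    intro i hi
    refine H (-i * orderOf g₁) 0 ?_ _ ?_ _ (by simpa using hy)
    · have h1 : (0 : ℤ) < i * (orderOf g₁ * orderOf g₂) :=
        mul_pos (by exact_mod_cast Nat.pos_of_ne_zero hi) hP
      linarith
    · convert M₁.mode_mem_weightSpace hg₁ hr₁ ha.2 (((-1 : ℤ) : ℂ) - twist g₁ r₁ + i) hw using 2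
      push_cast; field_simp; ring
  simp only [hright, mul_zero, finsum_zero, neg_zero] at hj
  rw [finsum_eq_single _ 0 fun i hi => by rw [hleft i hi, mul_zero], Ring.choose_zero_right,
    one_mul] at hj
  simpa using hj

-- The mirror image in the second argument, from the Jacobi identity with `(n, m) = (0, -1)`.
include hcomm in
lemma evalOne_C1Weight_right (f : M₃.restrictedDual)
    (hf : (f : Module.Dual ℂ W₃) ∈ M₃.C1.dualAnnihilator) {d₁ d₂ : ℂ}
    (H : ∀ p q : ℤ, orderOf g₂ * p + orderOf g₁ * q < 0 →
      ∀ w₁ ∈ M₁.weightSpace (d₁ + p / orderOf g₁), ∀ w₂ ∈ M₂.weightSpace (d₂ + q / orderOf g₂),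
        Y.evalOne hg₁ hg₂ hM₁ hM₂ f w₁ w₂ = 0)
    {x : W₁} (hx : x ∈ M₁.weightSpace d₁) {y : W₂} (hy : y ∈ M₂.C1Weight d₂) :
    Y.evalOne hg₁ hg₂ hM₁ hM₂ f x y = 0 := by
  have hT₁ : (orderOf g₁ : ℂ) ≠ 0 := Nat.cast_ne_zero.mpr hg₁.orderOf_pos.ne'
  have hT₂ : (orderOf g₂ : ℂ) ≠ 0 := Nat.cast_ne_zero.mpr hg₂.orderOf_pos.ne'
  have hP : (0 : ℤ) < orderOf g₁ * orderOf g₂ := by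
    exact_mod_cast Nat.mul_pos hg₁.orderOf_pos hg₂.orderOf_pos
  refine Submodule.span_induction
    (p := fun y _ => Y.evalOne hg₁ hg₂ hM₁ hM₂ f x y = 0) ?_ (by simp)
    (fun a b _ _ ha hb => by rw [map_add, ha, hb, add_zero])
    (fun c a _ ha => by rw [map_smul, ha, smul_zero]) hy
  rintro _ ⟨r₂, hr₂, n, hn, hnr, a, ha, w, hw, rfl⟩
  have ha' := le_iSup_eigen_inf hg₁ (eigen g₂ r₂ ⊓ weight V n)
    (fun b hb => ⟨map_mem_eigen hcomm.symm hb.1, map_mem_weight g₁ hb.2⟩) ha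
  clear ha
  refine Submodule.iSup_induction _
    (motive := fun a => Y.evalOne hg₁ hg₂ hM₁ hM₂ f x (M₂.mode (-1 - twist g₂ r₂) a w) = 0) ha'
    (fun r₁ a ha => ?_) (by simp)
    (fun a b ha hb => by simp only [map_add, LinearMap.add_apply, ha, hb, add_zero])
  by_cases hr₁ : r₁ < orderOf g₁
  swap
  · rw [iSup_neg hr₁, Submodule.mem_bot] at ha
    simp [ha]
  rw [iSup_pos hr₁] at ha
  have hj := Y.evalOne_jacobi hg₁ hg₂ hM₁ hM₂ hr₁ hr₂ ⟨ha.1, ha.2.1⟩ x w 0 (-1) f fun i z => by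
    have := M₃.mode_mem_C1_of_mul hcomm hg₁ hg₂ ⟨ha.1, ha.2.1⟩ ha.2.2 hn (by tauto) i z
    rw [show ((0 : ℤ) : ℂ) - twist g₁ r₁ + (((-1 : ℤ) : ℂ) - twist g₂ r₂) - i
      = -1 - twist g₁ r₁ - twist g₂ r₂ - i by push_cast; ring]
    exact (Submodule.mem_dualAnnihilator _).mp hf _ this
  have hleft : ∀ i : ℕ, Y.evalOne hg₁ hg₂ hM₁ hM₂ f
      (M₁.mode (((0 : ℤ) : ℂ) - twist g₁ r₁ + i) a x) w = 0 := by
    intro i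
    refine H ((n - i - 1) * orderOf g₁ + r₁) (-n * orderOf g₂ - r₂) ?_ _ ?_ _ ?_
    · have h1 : (orderOf g₂ : ℤ) * (r₁ + 1) ≤ orderOf g₂ * orderOf g₁ :=
        mul_le_mul_of_nonneg_left (by exact_mod_cast hr₁) (by positivity)
      have h2 : (0 : ℤ) < orderOf g₂ := by exact_mod_cast hg₂.orderOf_pos
      have h3 : (0 : ℤ) ≤ orderOf g₁ * r₂ := by positivity
      have h4 : (0 : ℤ) ≤ i * (orderOf g₁ * orderOf g₂) := by positivity
      linarith
    · convert M₁.mode_mem_weightSpace hg₁ hr₁ ⟨ha.1, ha.2.2⟩ (((0 : ℤ) : ℂ) - twist g₁ r₁ + i) hx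
        using 2
      simp only [twist]; push_cast; field_simp; ring
    · convert hw using 2
      simp only [twist]; push_cast; field_simp; ring
  have hright : ∀ i : ℕ, i ≠ 0 → Y.evalOne hg₁ hg₂ hM₁ hM₂ f x
      (M₂.mode (((-1 : ℤ) : ℂ) - twist g₂ r₂ + i) a w) = 0 := by
    intro i hi
    refine H 0 (-i * orderOf g₂) ?_ _ (by simpa using hx) _ ?_
    · have h1 : (0 : ℤ) < i * (orderOf g₁ * orderOf g₂) :=
        mul_pos (by exact_mod_cast Nat.pos_of_ne_zero hi) hP
      linarith
    · convert M₂.mode_mem_weightSpace hg₂ hr₂ ha.2 (((-1 : ℤ) : ℂ) - twist g₂ r₂ + i) hw using 2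
      push_cast; field_simp; ring
  simp only [hleft, mul_zero, finsum_zero] at hj
  rw [finsum_eq_single _ 0 fun i hi => by rw [hright i hi, mul_zero], Ring.choose_zero_right,
    one_mul, zero_eq_neg] at hj
  -- The leading term carries the nonzero phase `e^{-πiα}`.
  simpa using (mul_eq_zero.mp hj).resolve_left (exp_ne_zero _)

include hcomm in
/-- For `f` annihilating `C₁(W³)`, the functional `evalOne f` is determined by its values on
representatives of `W¹ / C₁(W¹)` and `W² / C₁(W²)`. -/
lemma evalOne_eq_zero (f : M₃.restrictedDual)
    (hf : (f : Module.Dual ℂ W₃) ∈ M₃.C1.dualAnnihilator) {S₁ : Submodule ℂ W₁}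
    {S₂ : Submodule ℂ W₂} (hS₁ : ∀ c, M₁.weightSpace c ≤ S₁ ⊔ M₁.C1Weight c)
    (hS₂ : ∀ c, M₂.weightSpace c ≤ S₂ ⊔ M₂.C1Weight c)
    (h : ∀ x ∈ S₁, ∀ y ∈ S₂, Y.evalOne hg₁ hg₂ hM₁ hM₂ f x y = 0) :
    Y.evalOne hg₁ hg₂ hM₁ hM₂ f = 0 := by
  have hT₁ : (0 : ℤ) < orderOf g₁ := by exact_mod_cast hg₁.orderOf_pos
  have hT₂ : (0 : ℤ) < orderOf g₂ := by exact_mod_cast hg₂.orderOf_pos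
  have hom : ∀ c₁ c₂ : ℂ, ∀ w₁ ∈ M₁.weightSpace c₁, ∀ w₂ ∈ M₂.weightSpace c₂,
      Y.evalOne hg₁ hg₂ hM₁ hM₂ f w₁ w₂ = 0 := by
    intro c₁ c₂
    obtain ⟨N₁, hN₁⟩ := hM₁.lower_truncated c₁
    obtain ⟨N₂, hN₂⟩ := hM₂.lower_truncated c₂
    -- `K` bounds the total weight above the truncation bounds `N₁`, `N₂`. When the excess is
    -- negative, one of the two weight spaces is zero.
    have main : ∀ (K : ℕ) (p q : ℤ), orderOf g₂ * (p - N₁) + orderOf g₁ * (q - N₂) < (K : ℤ) →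
        ∀ w₁ ∈ M₁.weightSpace (c₁ + p / orderOf g₁),
        ∀ w₂ ∈ M₂.weightSpace (c₂ + q / orderOf g₂), Y.evalOne hg₁ hg₂ hM₁ hM₂ f w₁ w₂ = 0 := by
      intro K
      induction K with
      | zero =>
        intro p q hpq w₁ hw₁ w₂ hw₂
        by_cases hp : p < N₁
        · rw [hN₁ p hp, Submodule.mem_bot] at hw₁
          simp [hw₁]
        · have hq : q < N₂ := by
            by_contra hq
            push Not at hp hq
            have h1 := mul_nonneg hT₂.le (sub_nonneg.mpr hp)
            have h2 := mul_nonneg hT₁.le (sub_nonneg.mpr hq)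
            push_cast at hpq
            linarith
          rw [hN₂ q hq, Submodule.mem_bot] at hw₂
          simp [hw₂]
      | succ K ih =>
        intro p q hpq w₁ hw₁ w₂ hw₂
        have H : ∀ p' q' : ℤ, orderOf g₂ * p' + orderOf g₁ * q' < 0 →
            ∀ w₁ ∈ M₁.weightSpace (c₁ + p / orderOf g₁ + p' / orderOf g₁),
            ∀ w₂ ∈ M₂.weightSpace (c₂ + q / orderOf g₂ + q' / orderOf g₂),
              Y.evalOne hg₁ hg₂ hM₁ hM₂ f w₁ w₂ = 0 := by
          intro p' q' hlt w₁ hw₁ w₂ hw₂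
          refine ih (p + p') (q + q') ?_ w₁ ?_ w₂ ?_
          · push_cast at hpq
            linarith
          · convert hw₁ using 2
            push_cast; ring
          · convert hw₂ using 2
            push_cast; ring
        obtain ⟨x₁, hx₁, y₁, hy₁, rfl⟩ := Submodule.mem_sup.mp (hS₁ _ hw₁)
        obtain ⟨x₂, hx₂, y₂, hy₂, rfl⟩ := Submodule.mem_sup.mp (hS₂ _ hw₂)
        -- `S₂` need not be graded; `x₂` is homogeneous as a difference of homogeneous vectors.
        have hx₂' : x₂ ∈ M₂.weightSpace (c₂ + q / orderOf g₂) := by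
          simpa using sub_mem hw₂ (M₂.C1Weight_le_weightSpace hg₂ _ hy₂)
        rw [map_add (Y.evalOne hg₁ hg₂ hM₁ hM₂ f (x₁ + y₁)),
          Y.evalOne_C1Weight_right hcomm hg₁ hg₂ hM₁ hM₂ f hf H hw₁ hy₂, map_add,
          LinearMap.add_apply, h x₁ hx₁ x₂ hx₂,
          Y.evalOne_C1Weight_left hcomm hg₁ hg₂ hM₁ hM₂ f hf H hy₁ hx₂']
        simp
    intro w₁ hw₁ w₂ hw₂
    refine main (orderOf g₂ * (0 - N₁) + orderOf g₁ * (0 - N₂) + 1).toNat 0 0 ?_ w₁ (by simpa) w₂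
      (by simpa)
    omega
  ext w₁ w₂
  have h₁ : w₁ ∈ ⨆ c, M₁.weightSpace c := by rw [M₁.iSup_weightSpace hM₁]; trivial
  have h₂ : w₂ ∈ ⨆ c, M₂.weightSpace c := by rw [M₂.iSup_weightSpace hM₂]; trivial
  rw [LinearMap.zero_apply, LinearMap.zero_apply]
  refine Submodule.iSup_induction _
    (motive := fun w₁ => Y.evalOne hg₁ hg₂ hM₁ hM₂ f w₁ w₂ = 0) h₁ (fun c₁ x₁ hx₁ => ?_)
    (by simp) fun x y hx hy => by rw [map_add, LinearMap.add_apply, hx, hy, add_zero]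
  exact Submodule.iSup_induction _
    (motive := fun w₂ => Y.evalOne hg₁ hg₂ hM₁ hM₂ f x₁ w₂ = 0) h₂
    (fun c₂ x₂ hx₂ => hom c₁ c₂ x₁ hx₁ x₂ hx₂) (by simp)
    fun x y hx hy => by rw [map_add, hx, hy, add_zero]

lemma evalOne_comp_L0 (f : M₃.restrictedDual) (w₁ : W₁) (w₂ : W₂) :
    Y.evalOne hg₁ hg₂ hM₁ hM₂
        ⟨(f : Module.Dual ℂ W₃) ∘ₗ M₃.mode 1 conformal, M₃.comp_L0_mem_restrictedDual f.2⟩ w₁ w₂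
      = Y.evalOne hg₁ hg₂ hM₁ hM₂ f w₁ (M₂.mode 1 conformal w₂)
        + (Y.evalOne hg₁ hg₂ hM₁ hM₂ f (M₁.mode 1 conformal w₁) w₂
          + Y.evalOne hg₁ hg₂ hM₁ hM₂ f (M₁.mode 0 conformal w₁) w₂) := by
  have hfin := Y.finite_support_pairing hg₁ hg₂ hM₁ hM₂ f.2 0
  have h3 : (fun n => (f : Module.Dual ℂ W₃)
      (Y.coeff (n + 1) 0 (M₁.mode 0 conformal w₁) w₂)).support.Finite :=
    (hfin (M₁.mode 0 conformal w₁) w₂).preimage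
      (Set.injOn_of_injective (add_left_injective (1 : ℂ)))
  have h23 : (fun n => (f : Module.Dual ℂ W₃) (Y.coeff n 0 (M₁.mode 1 conformal w₁) w₂)
      + (f : Module.Dual ℂ W₃)
        (Y.coeff (n + 1) 0 (M₁.mode 0 conformal w₁) w₂)).support.Finite :=
    ((hfin (M₁.mode 1 conformal w₁) w₂).union h3).subset (Function.support_add _ _)
  rw [← Y.finsum_pairing_add hg₁ hg₂ hM₁ hM₂ f (M₁.mode 0 conformal w₁) w₂ 1, evalOne_apply,
    evalOne_apply, evalOne_apply, ← finsum_add_distrib (hfin _ _) h3,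
    ← finsum_add_distrib (hfin _ _) h23]
  refine finsum_congr fun n => ?_
  rw [LinearMap.comp_apply, Y.L0_coeff hg₁ hg₂, map_add, map_add]

lemma evalOne_comp_L0_pow_eq_zero (f : M₃.restrictedDual)
    (h : Y.evalOne hg₁ hg₂ hM₁ hM₂ f = 0) (j : ℕ) :
    ∃ hj : (f : Module.Dual ℂ W₃) ∘ₗ (M₃.mode 1 conformal : Module.End ℂ W₃) ^ j
        ∈ M₃.restrictedDual, Y.evalOne hg₁ hg₂ hM₁ hM₂ ⟨_, hj⟩ = 0 := by
  induction j with
  | zero => exact ⟨f.2, h⟩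
  | succ j ih =>
    obtain ⟨hj, h0⟩ := ih
    refine ⟨M₃.comp_L0_mem_restrictedDual hj, ?_⟩
    ext w₁ w₂
    exact (Y.evalOne_comp_L0 hg₁ hg₂ hM₁ hM₂ ⟨_, hj⟩ w₁ w₂).trans (by simp [h0])

/-- Vanishing at `x = 1` is upgraded to vanishing of every coefficient. Since `evalOne` also
vanishes for all `f ∘ L(0)^j`, the sum of the relevant coefficients lies in the `L(0)`-stable
subspace `P` of vectors whose whole `L(0)`-orbit is killed by `f`. The coefficients have distinct
weights, so each one lies in `P`. -/
lemma pairing_eq_zero_of_evalOne_eq_zero (f : M₃.restrictedDual)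
    (h : Y.evalOne hg₁ hg₂ hM₁ hM₂ f = 0) (n : ℂ) (k : ℕ) (w₁ : W₁) (w₂ : W₂) :
    (f : Module.Dual ℂ W₃) (Y.coeff n k w₁ w₂) = 0 := by
  have hfin : {c : ℂ | ∃ w ∈ M₃.weightSpace c, (f : Module.Dual ℂ W₃) w ≠ 0}.Finite := f.2
  set L : Module.End ℂ W₃ := M₃.mode 1 conformal with hL
  have hpow : ∀ (j : ℕ) {c : ℂ} {w : W₃}, w ∈ M₃.weightSpace c →
      (L ^ j) w ∈ M₃.weightSpace c := fun j c w hw =>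
    Module.End.mapsTo_maxGenEigenspace_of_comm ((Commute.refl L).pow_right j) c hw
  set P : Submodule ℂ W₃ := ⨅ j : ℕ, LinearMap.ker ((f : Module.Dual ℂ W₃) ∘ₗ L ^ j) with hP
  have hPmem : ∀ x, x ∈ P ↔ ∀ j : ℕ, (f : Module.Dual ℂ W₃) ((L ^ j) x) = 0 := by
    intro x
    simp [hP, Submodule.mem_iInf]
  have hPL : P ≤ P.comap L := by
    intro x hx
    rw [Submodule.mem_comap, hPmem]
    intro j
    have := (hPmem x).mp hx (j + 1)
    rwa [pow_succ, Module.End.mul_apply] at this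
  have hom : ∀ c₁ c₂ : ℂ, ∀ w₁ ∈ M₁.weightSpace c₁, ∀ w₂ ∈ M₂.weightSpace c₂, ∀ n,
      (f : Module.Dual ℂ W₃) (Y.coeff n 0 w₁ w₂) = 0 := by
    intro c₁ c₂ w₁ hw₁ w₂ hw₂ n
    set x : ℂ → W₃ := fun c => Y.coeff (c₁ + c₂ - 1 - c) 0 w₁ w₂ with hx
    have hxw : ∀ c, x c ∈ M₃.weightSpace c := by
      intro c
      have := Y.coeff_mem_weightSpace hg₁ hg₂ hw₁ hw₂ (c₁ + c₂ - 1 - c) 0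
      rwa [show c₁ + c₂ - (c₁ + c₂ - 1 - c) - 1 = c by ring] at this
    have hsum : ∑ c ∈ hfin.toFinset, x c ∈ P := by
      rw [hPmem]
      intro j
      obtain ⟨hj, h0⟩ := Y.evalOne_comp_L0_pow_eq_zero hg₁ hg₂ hM₁ hM₂ f h j
      have h1 := LinearMap.congr_fun (LinearMap.congr_fun h0 w₁) w₂
      -- Reindexes the sum from the power of `x` to the weight of the coefficient.
      rw [evalOne_apply, ← finsum_comp_equiv (Equiv.subLeft (c₁ + c₂ - 1))] at h1
      rw [map_sum, map_sum, ← finsum_eq_sum_of_support_subset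
        (fun c => (f : Module.Dual ℂ W₃) ((L ^ j) (x c)))]
      · exact h1
      · intro c hc
        rw [Set.Finite.coe_toFinset]
        exact ⟨_, hpow j (hxw c), hc⟩
    have hxP := mem_of_sum_mem_of_mem_maxGenEigenspace L P hPL hfin.toFinset x
      (fun c _ => hxw c) hsum
    have hxn : Y.coeff n 0 w₁ w₂ = x (c₁ + c₂ - 1 - n) := by simp [hx]
    rw [hxn]
    by_contra hne
    refine hne ?_
    simpa using (hPmem _).mp (hxP (c₁ + c₂ - 1 - n)
      (hfin.mem_toFinset.mpr ⟨_, hxw _, hne⟩)) 0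
  induction k generalizing n w₁ with
  | zero =>
    have h₁ : w₁ ∈ ⨆ c, M₁.weightSpace c := by rw [M₁.iSup_weightSpace hM₁]; trivial
    have h₂ : w₂ ∈ ⨆ c, M₂.weightSpace c := by rw [M₂.iSup_weightSpace hM₂]; trivial
    refine Submodule.iSup_induction _
      (motive := fun w₁ => (f : Module.Dual ℂ W₃) (Y.coeff n 0 w₁ w₂) = 0) h₁
      (fun c₁ x₁ hx₁ => ?_) (by simp)
      fun x y hx hy => by rw [map_add, LinearMap.add_apply, map_add, hx, hy, add_zero]
    exact Submodule.iSup_induction _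
      (motive := fun w₂ => (f : Module.Dual ℂ W₃) (Y.coeff n 0 x₁ w₂) = 0) h₂
      (fun c₂ x₂ hx₂ => hom c₁ c₂ x₁ hx₁ x₂ hx₂ n) (by simp)
      fun x y hx hy => by rw [map_add, map_add, hx, hy, add_zero]
  | succ k ih =>
    -- The derivative property expresses `(k + 1)` times the coefficient of `(log x)^(k+1)` through
    -- coefficients of `(log x)^k`.
    have hd := congrArg (f : Module.Dual ℂ W₃) (Y.derivative w₁ w₂ (n + 1) k)
    rw [map_add, map_smul, map_smul, ih, add_sub_cancel_right, ih, smul_zero, zero_add] at hd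
    exact (smul_eq_zero.mp hd.symm).resolve_left (by exact_mod_cast Nat.succ_ne_zero k)

include hcomm hg₁ hg₂ hM₁ hM₂ in
/-- If `𝒴` is surjective, the annihilator of `C₁(W³)` in the restricted dual has dimension at most
`dim (W¹ / C₁(W¹)) * dim (W² / C₁(W²))`. -/
lemma finrank_C1Annihilator_le (hC₁ : M₁.IsC1Cofinite) (hC₂ : M₂.IsC1Cofinite)
    (hY : Y.IsSurjective) :
    FiniteDimensional ℂ M₃.C1Annihilator ∧ Module.finrank ℂ M₃.C1Annihilator
      ≤ Module.finrank ℂ (W₁ ⧸ M₁.C1) * Module.finrank ℂ (W₂ ⧸ M₂.C1) := by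
  obtain ⟨u₁, hu₁⟩ := M₁.exists_homogeneous_basis hg₁ hM₁ hC₁
  obtain ⟨u₂, hu₂⟩ := M₂.exists_homogeneous_basis hg₂ hM₂ hC₂
  have hle : M₃.C1Annihilator ≤ M₃.restrictedDual := inf_le_left
  set Ψ : M₃.C1Annihilator →ₗ[ℂ] (Fin (Module.finrank ℂ (W₁ ⧸ M₁.C1)) →
      Fin (Module.finrank ℂ (W₂ ⧸ M₂.C1)) → ℂ) :=
    { toFun := fun f i j => Y.evalOne hg₁ hg₂ hM₁ hM₂
        (Submodule.inclusion hle f) (u₁ i) (u₂ j)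
      map_add' := fun f f' => by ext i j; rw [map_add, map_add]; rfl
      map_smul' := fun c f => by ext i j; rw [map_smul, map_smul]; rfl } with hΨ
  have hinj : Function.Injective Ψ := by
    rw [← LinearMap.ker_eq_bot, LinearMap.ker_eq_bot']
    intro f hf
    have h0 := Y.evalOne_eq_zero hcomm hg₁ hg₂ hM₁ hM₂ (Submodule.inclusion hle f) f.2.2
      hu₁ hu₂ (by
        intro x hx y hy
        refine Submodule.span_induction (p := fun x _ => Y.evalOne hg₁ hg₂ hM₁ hM₂
          (Submodule.inclusion hle f) x y = 0) ?_ (by simp)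
          (fun a b _ _ ha hb => by rw [map_add, LinearMap.add_apply, ha, hb, add_zero])
          (fun c a _ ha => by rw [map_smul, LinearMap.smul_apply, ha, smul_zero]) hx
        rintro _ ⟨i, rfl⟩
        refine Submodule.span_induction (p := fun y _ => Y.evalOne hg₁ hg₂ hM₁ hM₂
          (Submodule.inclusion hle f) (u₁ i) y = 0) ?_ (by simp)
          (fun a b _ _ ha hb => by rw [map_add, ha, hb, add_zero])
          (fun c a _ ha => by rw [map_smul, ha, smul_zero]) hy
        rintro _ ⟨j, rfl⟩
        exact congrFun (congrFun hf i) j)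
    have h1 := Y.pairing_eq_zero_of_evalOne_eq_zero hg₁ hg₂ hM₁ hM₂ _ h0
    have h2 : Y.image ≤ LinearMap.ker (f : Module.Dual ℂ W₃) := by
      refine Submodule.span_le.mpr ?_
      rintro _ ⟨n, k, w₁, w₂, rfl⟩
      exact h1 n k w₁ w₂
    rw [show Y.image = ⊤ from hY, top_le_iff, LinearMap.ker_eq_top] at h2
    exact Subtype.ext h2
  refine ⟨FiniteDimensional.of_injective Ψ hinj, ?_⟩
  refine (LinearMap.finrank_le_finrank_of_injective hinj).trans_eq ?_
  rw [Module.finrank_pi_fintype]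
  simp

end TwistedIntertwiningOperator

/-! ### Quotients of twisted modules. -/

namespace WeakTwistedModule

variable {V : Type u} [AddCommGroup V] [Module ℂ V] [VertexOperatorAlgebra V] {g : Aut V}
  {W : Type v} [AddCommGroup W] [Module ℂ W] (M : WeakTwistedModule g W)

lemma exists_mode_add_eq_zero (hg : IsOfFinOrder g) (h : ℂ) (b : V) (w : W) :
    ∃ N : ℕ, ∀ i : ℕ, N ≤ i → M.mode (h + i) b w = 0 := by
  have hb := le_iSup_eigen_inf hg ⊤ (fun _ _ => trivial) (show b ∈ (⊤ : Submodule ℂ V) from trivial)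
  refine Submodule.iSup_induction _
    (motive := fun b => ∃ N : ℕ, ∀ i : ℕ, N ≤ i → M.mode (h + i) b w = 0) hb (fun r a ha => ?_)
    ⟨0, by simp⟩ ?_
  · by_cases hr : r < orderOf g
    swap
    · rw [iSup_neg hr, Submodule.mem_bot] at ha
      exact ⟨0, by simp [ha]⟩
    rw [iSup_pos hr] at ha
    by_cases hk : ∃ k : ℤ, h = k - twist g r
    · obtain ⟨k, rfl⟩ := hk
      exact M.exists_mode_eq_zero hr ha.1 k w
    · refine ⟨0, fun i _ => M.twist_support r hr a ha.1 w _ ?_⟩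
      rintro ⟨k, hk'⟩
      exact hk ⟨k - i, by push_cast; linear_combination hk'⟩
  · rintro a b ⟨N, hN⟩ ⟨N', hN'⟩
    refine ⟨max N N', fun i hi => ?_⟩
    rw [map_add, LinearMap.add_apply, hN i (le_of_max_le_left hi), hN' i (le_of_max_le_right hi),
      add_zero]

/-- The quotient of a twisted module by a subspace that is stable under all modes. -/
def quotient (hg : IsOfFinOrder g) (P : Submodule ℂ W)
    (hP : ∀ (n : ℂ) (a : V), ∀ w ∈ P, M.mode n a w ∈ P) : WeakTwistedModule g (W ⧸ P) where
  mode n :=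
    { toFun := fun a => P.mapQ P (M.mode n a) (hP n a)
      map_add' := fun a b => by ext w; simp
      map_smul' := fun c a => by ext w; simp }
  mode_support n hn := by
    ext a w
    simp [M.mode_support n hn]
  vacuum_mode n x := by
    obtain ⟨w, rfl⟩ := P.mkQ_surjective x
    simp only [LinearMap.coe_mk, AddHom.coe_mk, Submodule.mkQ_apply, Submodule.mapQ_apply,
      M.vacuum_mode]
    split_ifs <;> simp
  twist_support r hr a ha x n hn := by
    obtain ⟨w, rfl⟩ := P.mkQ_surjective x
    simp [M.twist_support r hr a ha w n hn]
  truncation r hr a ha x := by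
    obtain ⟨w, rfl⟩ := P.mkQ_surjective x
    obtain ⟨N, hN⟩ := M.truncation r hr a ha w
    exact ⟨N, fun k hk => by simp [hN k hk]⟩
  jacobi r hr a ha b x n m h := by
    obtain ⟨w, rfl⟩ := P.mkQ_surjective x
    have hfin : ∀ {F : ℕ → W}, (∃ N : ℕ, ∀ i, N ≤ i → F i = 0) → F.support.Finite := by
      rintro F ⟨N, hN⟩
      refine (Set.finite_Iio N).subset fun i hi => ?_
      by_contra! hlt
      exact hi (hN i (not_lt.mp hlt))
    -- The projection commutes with the three sums only because each is finite, hence the truncation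
    -- bounds that follow.
    have hj := congrArg P.mkQ (M.jacobi r hr a ha b w n m h)
    obtain ⟨N₁, hN₁⟩ := M.exists_mode_add_eq_zero hg h b w
    obtain ⟨N₂, hN₂⟩ := M.exists_mode_eq_zero hr ha m w
    obtain ⟨N₃, hN₃⟩ := VertexOperatorAlgebra.truncation a b
    rw [map_sub, map_finsum P.mkQ (hfin ⟨N₁, fun i hi => by rw [hN₁ i hi]; simp⟩),
      map_finsum P.mkQ (hfin ⟨N₂, fun i hi => by rw [hN₂ i hi]; simp⟩),
      map_finsum P.mkQ (hfin ⟨(N₃ - n).toNat, fun i hi => by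
        rw [hN₃ (n + i) (by omega)]; simp⟩)] at hj
    simp only [map_smul] at hj
    exact hj

lemma IsGeneralized.quotient {M : WeakTwistedModule g W} (hM : M.IsGeneralized)
    (hg : IsOfFinOrder g) (P : Submodule ℂ W)
    (hP : ∀ (n : ℂ) (a : V), ∀ w ∈ P, M.mode n a w ∈ P) : (M.quotient hg P hP).IsGeneralized := by
  have hle : ∀ c, (M.weightSpace c).map P.mkQ ≤ (M.quotient hg P hP).weightSpace c := by
    rintro c _ ⟨w, hw, rfl⟩
    have := map_mem_maxGenEigenspace_add (M.mode 1 conformal)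
      ((M.quotient hg P hP).mode 1 conformal) P.mkQ 0
      (fun x => by rw [zero_smul, add_zero]; rfl) c hw
    rwa [add_zero] at this
  have htop : ⨆ c, (M.weightSpace c).map P.mkQ = ⊤ := by
    rw [← Submodule.map_iSup, M.iSup_weightSpace hM, ← LinearMap.range_eq_map, P.range_mkQ]
  -- The images of the weight spaces already fill the quotient, so by independence they are its
  -- weight spaces; lower truncation is then inherited.
  have hge : ∀ c, (M.quotient hg P hP).weightSpace c ≤ (M.weightSpace c).map P.mkQ := by
    intro c
    have := (M.quotient hg P hP).iSupIndep_weightSpace.inf_iSup_le hle c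
    rwa [htop, inf_top_eq] at this
  refine ⟨DirectSum.isInternal_submodule_of_iSupIndep_of_iSup_eq_top
    (M.quotient hg P hP).iSupIndep_weightSpace (top_le_iff.mp (htop ▸ iSup_mono hle)), fun c => ?_⟩
  obtain ⟨N, hN⟩ := hM.lower_truncated c
  refine ⟨N, fun n hn => ?_⟩
  have := hge (c + (n : ℂ) / (orderOf g : ℂ))
  rwa [hN n hn, Submodule.map_bot, le_bot_iff] at this

end WeakTwistedModule

/-! ### The image of an intertwining operator and surjectivity for fusion products. -/

namespace TwistedIntertwiningOperator

variable {V : Type u} [AddCommGroup V] [Module ℂ V] [VertexOperatorAlgebra V] {g₁ g₂ : Aut V}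
    {W₁ : Type v₁} [AddCommGroup W₁] [Module ℂ W₁]
    {W₂ : Type v₂} [AddCommGroup W₂] [Module ℂ W₂]
    {W₃ : Type v₃} [AddCommGroup W₃] [Module ℂ W₃]
    {M₁ : WeakTwistedModule g₁ W₁} {M₂ : WeakTwistedModule g₂ W₂}
    {M₃ : WeakTwistedModule (g₁ * g₂) W₃} (Y : TwistedIntertwiningOperator M₁ M₂ M₃)

/-- The zero intertwining operator. -/
def zero (M₁ : WeakTwistedModule g₁ W₁) (M₂ : WeakTwistedModule g₂ W₂)
    (M₃ : WeakTwistedModule (g₁ * g₂) W₃) : TwistedIntertwiningOperator M₁ M₂ M₃ where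
  coeff _ _ := 0
  log_finite _ _ _ := by simp
  truncation _ _ _ := ⟨0, by simp⟩
  jacobi := by intros; simp
  derivative _ _ _ _ := by simp

lemma coeff_mem_image (n : ℂ) (k : ℕ) (w₁ : W₁) (w₂ : W₂) : Y.coeff n k w₁ w₂ ∈ Y.image :=
  Submodule.subset_span ⟨n, k, w₁, w₂, rfl⟩

/-- The image of an intertwining operator is stable under all modes. -/
lemma mode_mem_image (hcomm : Commute g₁ g₂) (hg₁ : IsOfFinOrder g₁) (hg₂ : IsOfFinOrder g₂)
    (s : ℂ) (a : V) (w : W₃) (hw : w ∈ Y.image) : M₃.mode s a w ∈ Y.image := by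
  have key : ∀ r₁ < orderOf g₁, ∀ r₂ < orderOf g₂, ∀ a ∈ eigen g₁ r₁ ⊓ eigen g₂ r₂,
      ∀ (h s : ℂ) (k : ℕ) (w₁ : W₁) (w₂ : W₂), M₃.mode s a (Y.coeff h k w₁ w₂) ∈ Y.image := by
    intro r₁ hr₁ r₂ hr₂ a ha h s k w₁ w₂
    by_cases ha0 : a = 0
    · simp [ha0]
    by_cases hs : ∃ m : ℤ, s = m - twist g₁ r₁ - twist g₂ r₂
    swap
    · obtain ⟨r₃, hr₃, ha₃, ε, hε, -⟩ := exists_twist_mul hcomm hg₁ hg₂ ha ha0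
      rw [M₃.twist_support r₃ hr₃ a ha₃ _ s]
      · exact zero_mem _
      · rintro ⟨l, hl⟩
        exact hs ⟨l + ε, by push_cast; linear_combination hl + hε⟩
    obtain ⟨m, rfl⟩ := hs
    obtain ⟨N, hN⟩ := Y.truncation w₁ w₂ h
    -- Downward induction on the index of the coefficient, starting where truncation makes it zero.
    -- The Jacobi identity with `n = 0` is solved for its `i = 0` term; the remaining first-sum
    -- terms have higher index, and the other two sums consist of coefficients of `𝒴`.
    have step : ∀ (d j : ℕ), N ≤ j + d → ∀ m : ℤ,
        M₃.mode (m - twist g₁ r₁ - twist g₂ r₂) a (Y.coeff (h + j) k w₁ w₂) ∈ Y.image := by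
      intro d
      induction d with
      | zero => intro j hj m; rw [hN j hj k, map_zero]; exact zero_mem _
      | succ d ih =>
        intro j hj m
        have hJ := Y.jacobi r₁ r₂ hr₁ hr₂ a ha w₁ w₂ 0 m (h + j) k
        have hmem : ∀ {F : ℕ → W₃}, (∀ i, F i ∈ Y.image) → ∑ᶠ i, F i ∈ Y.image := fun hF =>
          finsum_induction (· ∈ Y.image) (zero_mem _) (fun _ _ => add_mem) hF
        rw [sub_eq_iff_eq_add, finsum_eq_sum_range (N := N + 1)
          (fun i : ℕ => ((-1 : ℂ) ^ i * Ring.choose (((0 : ℤ) : ℂ) - twist g₁ r₁) i) • _)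
          fun i hi => by
            rw [show h + (j : ℂ) + i = h + (j + i : ℕ) by push_cast; ring,
              hN (j + i) (by omega) k, map_zero, smul_zero],
          Finset.sum_range_succ'] at hJ
        have h0 := eq_sub_of_add_eq' hJ
        rw [Ring.choose_zero_right, pow_zero, one_mul, one_smul] at h0
        rw [show (m : ℂ) - twist g₁ r₁ - twist g₂ r₂ = ((0 : ℤ) : ℂ) - twist g₁ r₁
          + (m - twist g₂ r₂) - (0 : ℕ) by push_cast; ring,
          show h + (j : ℂ) = h + j + (0 : ℕ) by push_cast; ring, h0]
        refine sub_mem (add_mem (hmem fun i => Submodule.smul_mem _ _ (Y.coeff_mem_image _ _ _ _))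
          (hmem fun i => Submodule.smul_mem _ _ (Y.coeff_mem_image _ _ _ _)))
          (Submodule.sum_mem _ fun i _ => Submodule.smul_mem _ _ ?_)
        have := ih (j + (i + 1)) (by omega) (m - (i + 1))
        rwa [show ((m - (i + 1) : ℤ) : ℂ) - twist g₁ r₁ - twist g₂ r₂ = ((0 : ℤ) : ℂ)
            - twist g₁ r₁ + (m - twist g₂ r₂) - (i + 1 : ℕ) by push_cast; ring,
          show h + ((j + (i + 1) : ℕ) : ℂ) = h + j + (i + 1 : ℕ) by push_cast; ring] at this
    simpa using step N 0 (by omega) m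
  have ha := le_iSup_eigen_inf_eigen_inf hcomm hg₁ hg₂ ⊤ (fun _ _ => trivial)
    (fun _ _ => trivial) (show a ∈ (⊤ : Submodule ℂ V) from trivial)
  refine Submodule.span_induction (p := fun w _ => M₃.mode s a w ∈ Y.image) ?_ (by simp)
    (fun x y _ _ hx hy => by rw [map_add]; exact add_mem hx hy)
    (fun c x _ hx => by rw [map_smul]; exact Submodule.smul_mem _ _ hx) hw
  rintro _ ⟨n, k, w₁, w₂, rfl⟩
  refine (show (⨆ (r₁ : ℕ) (_ : r₁ < orderOf g₁) (r₂ : ℕ) (_ : r₂ < orderOf g₂),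
      eigen g₁ r₁ ⊓ eigen g₂ r₂ ⊓ ⊤) ≤
    Y.image.comap ((M₃.mode s).flip (Y.coeff n k w₁ w₂)) from ?_) ha
  exact iSup₂_le fun r₁ hr₁ => iSup₂_le fun r₂ hr₂ b hb =>
    key r₁ hr₁ r₂ hr₂ b hb.1 n s k w₁ w₂

/-- Both the projection to `W³ / Im 𝒴` and the zero map turn `𝒴` into the zero intertwining
operator. Uniqueness makes them equal, so the quotient vanishes. -/
lemma IsFusionProduct.isSurjective {Y : TwistedIntertwiningOperator M₁ M₂ M₃}
    (hY : Y.IsFusionProduct) (hcomm : Commute g₁ g₂) (hg₁ : IsOfFinOrder g₁)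
    (hg₂ : IsOfFinOrder g₂) : Y.IsSurjective := by
  have hg₃ := hcomm.isOfFinOrder_mul hg₁ hg₂
  have hP := Y.mode_mem_image hcomm hg₁ hg₂
  have huniq := (hY.2 (W₃ ⧸ Y.image) (M₃.quotient hg₃ Y.image hP) (hY.1.quotient hg₃ _ hP)
    (zero M₁ M₂ _)).unique
    (y₁ := Y.image.mkQ) (y₂ := 0)
    ⟨fun _ _ _ => rfl, fun n k w₁ w₂ =>
      ((Submodule.Quotient.mk_eq_zero _).mpr (Y.coeff_mem_image n k w₁ w₂)).symm⟩
    ⟨fun _ _ _ => by simp, fun _ _ _ _ => rfl⟩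
  rw [IsSurjective, ← Submodule.ker_mkQ Y.image, huniq, LinearMap.ker_zero]

end TwistedIntertwiningOperator

end

/-! ### The theorem. -/

theorem mainTheorem1 {V : Type u} [AddCommGroup V] [Module ℂ V] [VertexOperatorAlgebra V]
    (g₁ g₂ : VertexOperatorAlgebra.Aut V) (hcomm : Commute g₁ g₂) (hg₁ : IsOfFinOrder g₁) (hg₂ : IsOfFinOrder g₂)
    {W₁ : Type v₁} [AddCommGroup W₁] [Module ℂ W₁]
    {W₂ : Type v₂} [AddCommGroup W₂] [Module ℂ W₂]
    (M₁ : WeakTwistedModule g₁ W₁) (M₂ : WeakTwistedModule g₂ W₂)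
    (hM₁ : M₁.IsGeneralized) (hM₂ : M₂.IsGeneralized)
    (hC₁ : M₁.IsC1Cofinite) (hC₂ : M₂.IsC1Cofinite) :
    (∀ (W₃ : Type v₃) [AddCommGroup W₃] [Module ℂ W₃] (M₃ : WeakTwistedModule (g₁ * g₂) W₃)
        (Y : TwistedIntertwiningOperator M₁ M₂ M₃), M₃.IsGeneralized → Y.IsSurjective →
      (FiniteDimensional ℂ M₃.C1Annihilator ∧
        Module.finrank ℂ M₃.C1Annihilator
          ≤ Module.finrank ℂ (W₁ ⧸ M₁.C1) * Module.finrank ℂ (W₂ ⧸ M₂.C1)) ∧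
      M₃.IsC1Cofinite ∧
      Module.finrank ℂ (W₃ ⧸ M₃.C1)
        ≤ Module.finrank ℂ (W₁ ⧸ M₁.C1) * Module.finrank ℂ (W₂ ⧸ M₂.C1)) ∧
    (∀ (P : Type v₃) [AddCommGroup P] [Module ℂ P] (MP : WeakTwistedModule (g₁ * g₂) P)
        (Y : TwistedIntertwiningOperator M₁ M₂ MP), Y.IsFusionProduct →
      MP.IsC1Cofinite) := by
  have hg₃ := hcomm.isOfFinOrder_mul hg₁ hg₂
  have main : ∀ (W₃ : Type v₃) [AddCommGroup W₃] [Module ℂ W₃]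
      (M₃ : WeakTwistedModule (g₁ * g₂) W₃) (Y : TwistedIntertwiningOperator M₁ M₂ M₃),
      M₃.IsGeneralized → Y.IsSurjective →
      (FiniteDimensional ℂ M₃.C1Annihilator ∧
        Module.finrank ℂ M₃.C1Annihilator
          ≤ Module.finrank ℂ (W₁ ⧸ M₁.C1) * Module.finrank ℂ (W₂ ⧸ M₂.C1)) ∧
      M₃.IsC1Cofinite ∧
      Module.finrank ℂ (W₃ ⧸ M₃.C1)
        ≤ Module.finrank ℂ (W₁ ⧸ M₁.C1) * Module.finrank ℂ (W₂ ⧸ M₂.C1) := by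
    intro W₃ _ _ M₃ Y hM₃ hY
    obtain ⟨hfin, hle⟩ := Y.finrank_C1Annihilator_le hcomm hg₁ hg₂ hM₁ hM₂ hC₁ hC₂ hY
    obtain ⟨hC₃, hle'⟩ := M₃.finrank_quotient_C1_le hg₃ hM₃
    exact ⟨⟨hfin, hle⟩, hC₃, hle'.trans hle⟩
  refine ⟨main, fun P _ _ MP Y hY => ?_⟩
  exact (main P MP Y hY.1 (hY.isSurjective hcomm hg₁ hg₂)).2.1
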